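/- Let $X$ be a connected compact complex manifold. A Schottky pair in $X$ consists of two disjoint (non-empty) connected compact complex submanifolds $C_0,C_1\subset X$ and a holomorphic $\mathbb{C}^*$-action $\lambda\mapsto g_\lambda\in\mathrm{Aut}(X)$ with fixed point set $C_0\cup C_1$ that is free and proper on $\Omega:=X\setminus(C_0\cup C_1)$. Let $(C_0,C_1)$ be a Schottky pair and let $\varphi\colon X\to[0,1]$ be a continuous function, smooth on $\Omega$, with $\varphi^{-1}(0)=C_0$, $\varphi^{-1}(1)=C_1$ and $$\varphi(g_\lambda(x))=\frac{|\lambda|^2\varphi(x)}{1+(|\lambda|^2-1)\varphi(x)}\qquad(\lambda\in\mathbb{C}^*,\ x\in X).$$ Let $r\ge 0$ be an integer. For $1\le j\le r$ let $f_j\in\mathrm{Aut}(X)$, $\varepsilon_j\in(0,1/2)$ and $\lambda_j\in\mathbb{C}^*$ with $|\lambda_j|=(1-\varepsilon_j)/\varepsilon_j$, and put $U_j=f_j(\{\varphi<\varepsilon_j\})$, $V_j=f_j(\{\varphi>1-\varepsilon_j\})$ and $\gamma_j=f_j\circ g_{\lambda_j}\circ f_j^{-1}$. Assume that $U_1,\dots,U_r,V_1,\dots,V_r$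 have pairwise disjoint closures. Let $\Gamma\subset\mathrm{Aut}(X)$ be the (Schottky) group generated by $\gamma_1,\dots,\gamma_r$, and put $$\mathcal{F}_\Gamma=X\setminus\bigcup_{j=1}^r(U_j\cup V_j),\qquad \mathcal{U}_\Gamma=\bigcup_{\gamma\in\Gamma}\gamma(\mathcal{F}_\Gamma).$$ Then the following hold. 1. $\Gamma$ is free on $\gamma_1,\dots,\gamma_r$ and acts freely and properly (as a discrete group) on $\mathcal{U}_\Gamma$. 2. $\mathcal{F}_\Gamma$ is connected and is a fundamental domain for the $\Gamma$-action on $\mathcal{U}_\Gamma$: it is closed in $\mathcal{U}_\Gamma$ and is the closure of its interior, its $\Gamma$-translates cover $\mathcal{U}_\Gamma$ and form a locally finite family, and translates by distinct elements of $\Gamma$ have disjoint interiors. 3. $\mathcal{U}_\Gamma$ is open in $X$, and the quotient $Q_\Gamma=\mathcal{U}_\Gamma/\Gamma$, with the quotient topology, is a connected compact (Hausdorff, second countable) complex manifold, with a complex structure for which $\mathcal{U}_\Gamma\to Q_\Gamma$ is locally biholomorphic. 4. If $X$ is simply connected and $C_0$ and $C_1$ both have codimension at least $2$ in $X$, then $\pi_1(Q_\Gamma)\cong\Gamma$.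 -/

import Mathlib

open scoped Manifold ContDiff Topology

/-- The group `Aut(X)` of biholomorphic self-maps of a complex manifold `X` modelled on the
complex vector space `E`. -/
abbrev HolAut (E X : Type*) [NormedAddCommGroup E] [NormedSpace ℂ E]
    [TopologicalSpace X] [ChartedSpace E X] : Type _ :=
  X ≃ₘ^ω⟮𝓘(ℂ, E), 𝓘(ℂ, E)⟯ X

namespace HolAut

variable {E X : Type*} [NormedAddCommGroup E] [NormedSpace ℂ E]
  [TopologicalSpace X] [ChartedSpace E X]

/-- The product of `Aut(X)` is composition: `(f * g) x = f (g x)`. -/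
noncomputable instance : Group (HolAut E X) where
  mul f g := Diffeomorph.trans g f
  one := Diffeomorph.refl 𝓘(ℂ, E) X ω
  inv f := Diffeomorph.symm f
  mul_assoc _ _ _ := Diffeomorph.ext fun _ => rfl
  one_mul _ := Diffeomorph.ext fun _ => rfl
  mul_one _ := Diffeomorph.ext fun _ => rfl
  inv_mul_cancel f := Diffeomorph.ext fun x => Diffeomorph.symm_apply_apply f x

noncomputable instance : MulAction (HolAut E X) X where
  smul f x := f x
  one_smul _ := rfl
  mul_smul _ _ _ := rfl

theorem smul_def (f : HolAut E X) (x : X) : f • x = f x := rfl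

theorem mul_apply (f g : HolAut E X) (x : X) : (f * g) x = f (g x) := rfl

end HolAut

/-- `C` is a complex submanifold of codimension `k` of the complex manifold `X`: around each of
its points there is a holomorphic chart of `X` in which `C` is an affine subspace of
codimension `k`. -/
def IsComplexSubmanifold (E : Type*) {X : Type*} [NormedAddCommGroup E] [NormedSpace ℂ E]
    [TopologicalSpace X] [ChartedSpace E X] (k : ℕ) (C : Set X) : Prop :=
  ∀ x ∈ C, ∃ e ∈ IsManifold.maximalAtlas 𝓘(ℂ, E) ω X, x ∈ e.source ∧
    ∃ L : Submodule ℂ E, Module.finrank ℂ (E ⧸ L) = k ∧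
      ∀ y ∈ e.source, y ∈ C ↔ e y - e x ∈ L

/-- A Schottky pair in the complex manifold `X`: two disjoint connected compact complex
submanifolds together with a holomorphic `ℂ*`-action `a ↦ g a` whose fixed point set is their
union and which is free and proper on the complement of that union. -/
structure SchottkyPair (E X : Type*) [NormedAddCommGroup E] [NormedSpace ℂ E]
    [TopologicalSpace X] [ChartedSpace E X] where
  C₀ : Set X
  C₁ : Set X
  connected₀ : IsConnected C₀
  connected₁ : IsConnected C₁
  compact₀ : IsCompact C₀
  compact₁ : IsCompact C₁
  submanifold₀ : ∃ k, IsComplexSubmanifold E k C₀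
  submanifold₁ : ∃ k, IsComplexSubmanifold E k C₁
  disjoint : Disjoint C₀ C₁
  g : ℂˣ →* HolAut E X
  holomorphic : ContMDiff (𝓘(ℂ, ℂ).prod 𝓘(ℂ, E)) 𝓘(ℂ, E) ω (fun p : ℂˣ × X => g p.1 p.2)
  fixedPoints : {x : X | ∀ a, g a x = x} = C₀ ∪ C₁
  free : ∀ a, ∀ x ∈ (C₀ ∪ C₁)ᶜ, g a x = x → a = 1
  /-- With `Ω` the complement of `C₀ ∪ C₁`, which is invariant, the map
  `ℂ* × Ω → Ω × Ω`, `(a, x) ↦ (g a x, x)` is proper. -/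
  proper : IsProperMap (((C₀ ∪ C₁)ᶜ ×ˢ (C₀ ∪ C₁)ᶜ).restrictPreimage
    (fun p : ℂˣ × X => (g p.1 p.2, p.2)))

/-- The auxiliary functions `φ : X → [0, 1]` of a Schottky pair: continuous, smooth in the real
sense off `C₀ ∪ C₁`, with `C₀ = {φ = 0}` and `C₁ = {φ = 1}`, and equivariant for the action
`t · s = t² s / (1 + (t² - 1) s)` of the positive reals on `[0, 1]`. -/
structure SchottkyPair.IsAuxiliary {E X : Type*} [NormedAddCommGroup E] [NormedSpace ℂ E]
    [TopologicalSpace X] [ChartedSpace E X] (S : SchottkyPair E X) (φ : X → ℝ) : Prop where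
  continuous : Continuous φ
  smooth : ContMDiffOn 𝓘(ℝ, E) 𝓘(ℝ, ℝ) ∞ φ (S.C₀ ∪ S.C₁)ᶜ
  mem_Icc : ∀ x, φ x ∈ Set.Icc (0 : ℝ) 1
  zero_set : φ ⁻¹' {0} = S.C₀
  one_set : φ ⁻¹' {1} = S.C₁
  equivariant : ∀ (a : ℂˣ) (x : X),
    φ (S.g a x) = ‖(a : ℂ)‖ ^ 2 * φ x / (1 + (‖(a : ℂ)‖ ^ 2 - 1) * φ x)

/-- The choices that define a Schottky group of rank `r` associated with a Schottky pair. -/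
structure SchottkyData {E X : Type*} [NormedAddCommGroup E] [NormedSpace ℂ E]
    [TopologicalSpace X] [ChartedSpace E X] (S : SchottkyPair E X) (r : ℕ) where
  φ : X → ℝ
  auxiliary : S.IsAuxiliary φ
  f : Fin r → HolAut E X
  ε : Fin r → ℝ
  ε_pos : ∀ j, 0 < ε j
  ε_lt : ∀ j, ε j < 1 / 2
  lam : Fin r → ℂˣ
  norm_lam : ∀ j, ‖(lam j : ℂ)‖ = (1 - ε j) / ε j
  /-- The `2r` sets `U_j = f_j {φ < ε_j}` and `V_j = f_j {φ > 1 - ε_j}` have pairwise disjoint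
  closures. -/
  disjoint_closure : Pairwise fun i i' : Fin r ⊕ Fin r =>
    Disjoint
      (closure (Sum.elim (fun j => f j '' {x | φ x < ε j})
        (fun j => f j '' {x | 1 - ε j < φ x}) i))
      (closure (Sum.elim (fun j => f j '' {x | φ x < ε j})
        (fun j => f j '' {x | 1 - ε j < φ x}) i'))

namespace SchottkyData

variable {E X : Type*} [NormedAddCommGroup E] [NormedSpace ℂ E]
  [TopologicalSpace X] [ChartedSpace E X] {S : SchottkyPair E X} {r : ℕ} (D : SchottkyData S r)

/-- `U_j = f_j {φ < ε_j}` -/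
def U (j : Fin r) : Set X := D.f j '' {x | D.φ x < D.ε j}

/-- `V_j = f_j {φ > 1 - ε_j}` -/
def V (j : Fin r) : Set X := D.f j '' {x | 1 - D.ε j < D.φ x}

/-- `γ_j = f_j ∘ g_{λ_j} ∘ f_j⁻¹` -/
noncomputable def gen (j : Fin r) : HolAut E X := D.f j * S.g (D.lam j) * (D.f j)⁻¹

/-- The Schottky group `Γ`. -/
noncomputable def group : Subgroup (HolAut E X) := Subgroup.closure (Set.range D.gen)

/-- `F_Γ`, the complement of the union of all `U_j` and `V_j`. -/
def fundamentalSet : Set X := (⋃ j, (D.U j ∪ D.V j))ᶜ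

/-- `U_Γ`, the union of the `γ(F_Γ)` with `γ ∈ Γ`, as a `Γ`-stable subset of `X`. -/
noncomputable def domain : SubMulAction D.group X where
  carrier := ⋃ γ : D.group, (fun x => γ • x) '' D.fundamentalSet
  smul_mem' := by
    intro γ x hx
    obtain ⟨δ, y, hy, rfl⟩ := Set.mem_iUnion.1 hx
    exact Set.mem_iUnion.2 ⟨γ * δ, y, hy, mul_smul γ δ y⟩

/-- The orbit space `Q_Γ = U_Γ / Γ`, with the quotient topology. -/
abbrev orbitSpace : Type _ := MulAction.orbitRel.Quotient D.group D.domain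

/-- The projection `U_Γ → Q_Γ`. -/
noncomputable def proj (x : D.domain) : D.orbitSpace := Quotient.mk _ x

end SchottkyData

/-- `F` is a fundamental domain for the action of the discrete group `G` on the space `T`:
a closed set that is the closure of its interior, whose translates cover `T`, are locally finite,
and have pairwise disjoint interiors. -/
structure IsTopFundamentalDomain (G : Type*) {T : Type*} [Group G] [MulAction G T]
    [TopologicalSpace T] (F : Set T) : Prop where
  isClosed : IsClosed F
  closure_interior : closure (interior F) = F
  cover : ∀ x : T, ∃ γ : G, ∃ y ∈ F, γ • y = x
  disjoint_interior : ∀ γ δ : G, γ ≠ δ →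
    Disjoint ((fun x => γ • x) '' interior F) ((fun x => δ • x) '' interior F)
  locallyFinite : LocallyFinite fun γ : G => (fun x => γ • x) '' F

/-!
The discs `U_j` and `V_j` play ping-pong. Because of `|λ_j| = (1 - ε_j) / ε_j`, the generator `γ_j`
maps the complement of `U_j` onto the closure of `V_j`, and its inverse maps the complement of `V_j`
onto the closure of `U_j` (`SchottkyData.isPingPong`). Everything about the action follows from
this and the disjointness of the closures of the discs. A reduced word `s₁ ⋯ sₙ₊₁` has a disc
`s₁ ⋯ sₙ (B sₙ₊₁)`, where `B s` is the disc of the letter `s`. Discs of different words of equal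
length have disjoint closures, and the closure of the disc of a word lies in the disc of each
proper nonempty initial segment. The complements of the discs of the words of length `n + 1`, called
levels here, therefore form an increasing sequence of closed sets, each in the interior of the next;
level `0` is the fundamental set, and the union of all levels is the domain `U_Γ`
(`IsPingPong.iUnion_level`). A word of length at least two moves level `0` off itself, which gives
freeness (`IsPingPong.eq_one_of_fixed`), and only finitely many translates of level `0` meet a given
level, which gives properness and local finiteness (`IsPingPong.finite_smul_mem_level`).

The disc of a word is a translate of `{φ < ε}` or `{φ > 1 - ε}`. The flow of `g` pushes it, minus
the corresponding translate of `C₀` or `C₁`, to its boundary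
(`SchottkyPair.IsAuxiliary.exists_push`). So each level is a retract of `X` minus a finite disjoint
union of translates of `C₀` and `C₁` (`SchottkyData.exists_level_retraction`). These submanifolds
have real codimension at least `2`, since they are proper, closed and nonempty, hence each level is
path-connected. If their complex codimension is at least `2`, then removing them does not affect
simple connectedness, and each level, thus also `U_Γ`, is simply connected.

The last point uses that a map `f : Y → X` into a simply connected, locally path-connected space has
simply connected source if the points of `X` have arbitrarily small neighbourhoods with simply
connected preimages (`simplyConnectedSpace_of_locally`). Over each of these preimages one chooses
compatibly homotopy classes of paths from a base point; the differences between two such choices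
form a locally constant cocycle on `X` with values in `π₁(Y)`. The cocycle is a coboundary because
`X` is simply connected (`exists_coboundary`), so the choices can be made compatible on all of `Y`,
and then all loops in `Y` are null-homotopic (`simplyConnectedSpace_of_section`). For the inclusion
of the complement of a submanifold, the local condition says that the complement of a linear
subspace of real codimension at least `3` is simply connected.

Finally `U_Γ → Q_Γ` is a covering with deck group `Γ`. Local inverses followed by charts of `U_Γ`
are an atlas of `Q_Γ`, whose coordinate changes are holomorphic because two local inverses differ
locally by an element of `Γ` (`IsLocalHomeomorph.exists_isManifold`). When `U_Γ` is simply
connected, the deck group is the fundamental group of the quotient.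
-/

/-! ### Sections of the fundamental groupoid and simple connectedness -/

section PathSections

variable {X Y : Type*} [TopologicalSpace X] [TopologicalSpace Y]

theorem Path.Homotopic.Quotient.trans_left_cancel {y₀ v w : Y} (a : Path.Homotopic.Quotient y₀ v)
    {p q : Path.Homotopic.Quotient v w} (h : a.trans p = a.trans q) : p = q := by
  have h' := congrArg (fun b => a.symm.trans b) h
  simpa [← Path.Homotopic.Quotient.trans_assoc] using h'

theorem Path.Homotopic.Quotient.trans_right_cancel {y₀ v w : Y}
    {p q : Path.Homotopic.Quotient y₀ v} (a : Path.Homotopic.Quotient v w)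
    (h : p.trans a = q.trans a) : p = q := by
  have h' := congrArg (fun b => b.trans a.symm) h
  simpa [Path.Homotopic.Quotient.trans_assoc] using h'

/-- A family `s y` of homotopy classes of paths from `y₀` to `y` that is locally compatible with
concatenation of paths is compatible with all paths. -/
theorem section_trans_of_local {y₀ : Y} (s : ∀ y, Path.Homotopic.Quotient y₀ y)
    (hs : ∀ y, ∃ N ∈ 𝓝 y, ∀ (v w : Y) (p : Path v w), Set.range p ⊆ N →
      s w = (s v).trans (.mk p)) {v w : Y} (p : Path v w) :
    s w = (s v).trans (.mk p) := by
  choose N hN hsN using hs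
  obtain ⟨t, ht0, htm, ⟨n, hn⟩, ht⟩ :=
    exists_monotone_Icc_subset_open_cover_unitInterval
      (c := fun y : Y => p ⁻¹' interior (N y)) (fun y => isOpen_interior.preimage p.continuous)
      (fun x _ => Set.mem_iUnion.2 ⟨p x, mem_interior_iff_mem_nhds.2 (hN _)⟩)
  have claim : ∀ k, s (p (t k)) = (s (p 0)).trans (.mk (p.subpath 0 (t k))) := by
    intro k
    induction k with
    | zero => rw [ht0]; simp
    | succ k ih =>
      obtain ⟨y, hy⟩ := ht k
      rw [hsN y _ _ (p.subpath (t k) (t (k + 1))), ih, Path.Homotopic.Quotient.trans_assoc,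
        ← Path.Homotopic.Quotient.mk_trans]
      · congr 1
        exact Path.Homotopic.Quotient.eq.2 ⟨Path.Homotopy.subpathTransSubpath p _ _ _⟩
      · rw [Path.range_subpath_of_le _ _ _ (htm (Nat.le_succ k))]
        rintro _ ⟨x, hx, rfl⟩
        exact interior_subset (hy hx)
  have h1 := claim n
  rw [hn n le_rfl, Path.subpath_zero_one] at h1
  have aux : ∀ (v' w' : Y) (hv : v' = v) (hw : w' = w),
      s w' = (s v').trans (.mk (p.cast hv hw)) → s w = (s v).trans (.mk p) := by
    rintro _ _ rfl rfl h; exact h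
  exact aux _ _ _ _ h1

/-- A path-connected space whose fundamental groupoid has a locally compatible section is simply
connected. -/
theorem simplyConnectedSpace_of_section [PathConnectedSpace Y] {y₀ : Y}
    (s : ∀ y, Path.Homotopic.Quotient y₀ y)
    (hs : ∀ y, ∃ N ∈ 𝓝 y, ∀ (v w : Y) (p : Path v w), Set.range p ⊆ N →
      s w = (s v).trans (.mk p)) : SimplyConnectedSpace Y := by
  rw [simply_connected_iff_paths_homotopic']
  refine ⟨inferInstance, fun {v w} p q => ?_⟩
  rw [← Path.Homotopic.Quotient.eq]
  exact Path.Homotopic.Quotient.trans_left_cancel (s v)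
    ((section_trans_of_local s hs p).symm.trans (section_trans_of_local s hs q))

theorem IsSimplyConnected.homotopic_of_range_subset {A : Set Y} (hA : IsSimplyConnected A)
    {v w : Y} (p q : Path v w) (hp : Set.range p ⊆ A) (hq : Set.range q ⊆ A) :
    p.Homotopic q := by
  have := hA.simplyConnectedSpace
  have hp' : ∀ t, p t ∈ A := fun t => hp ⟨t, rfl⟩
  have hq' : ∀ t, q t ∈ A := fun t => hq ⟨t, rfl⟩
  have hv : v ∈ A := by simpa using hp' 0
  have hw : w ∈ A := by simpa using hp' 1
  let p' : Path (⟨v, hv⟩ : A) ⟨w, hw⟩ :=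
    { toFun := fun t => ⟨p t, hp' t⟩, source' := by simp, target' := by simp }
  let q' : Path (⟨v, hv⟩ : A) ⟨w, hw⟩ :=
    { toFun := fun t => ⟨q t, hq' t⟩, source' := by simp, target' := by simp }
  exact (SimplyConnectedSpace.paths_homotopic p' q').map
    (⟨Subtype.val, continuous_subtype_val⟩ : C(A, Y))

/-- On a simply connected subset, the fundamental groupoid has a compatible section. -/
theorem IsSimplyConnected.exists_section [PathConnectedSpace Y] {A : Set Y}
    (hA : IsSimplyConnected A) (y₀ : Y) :
    ∃ τ : ∀ y, Path.Homotopic.Quotient y₀ y, ∀ (v w : Y) (p : Path v w), Set.range p ⊆ A →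
      τ w = (τ v).trans (.mk p) := by
  classical
  obtain ⟨a, ha⟩ := hA.nonempty
  have hJ : ∀ v ∈ A, JoinedIn A a v := fun v hv => hA.isPathConnected.joinedIn a ha v hv
  let σ : Path y₀ a := PathConnectedSpace.somePath y₀ a
  refine ⟨fun v => if hv : v ∈ A then .mk (σ.trans (hJ v hv).somePath)
    else .mk (PathConnectedSpace.somePath y₀ v), fun v w p hp => ?_⟩
  have hv : v ∈ A := by simpa using hp ⟨0, rfl⟩
  have hw : w ∈ A := by simpa using hp ⟨1, rfl⟩
  simp only [dif_pos hv, dif_pos hw, Path.Homotopic.Quotient.mk_trans,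
    Path.Homotopic.Quotient.trans_assoc]
  congr 1
  rw [← Path.Homotopic.Quotient.mk_trans, Path.Homotopic.Quotient.eq]
  refine hA.homotopic_of_range_subset _ _ ?_ ?_
  · rintro _ ⟨t, rfl⟩; exact (hJ w hw).somePath_mem t
  · rw [Path.trans_range]
    refine Set.union_subset ?_ hp
    rintro _ ⟨t, rfl⟩; exact (hJ v hv).somePath_mem t

/-- A union of two simply connected open sets with path-connected intersection is simply
connected. -/
theorem simplyConnectedSpace_of_union {A B : Set Y} (hAo : IsOpen A) (hBo : IsOpen B)
    (hA : IsSimplyConnected A) (hB : IsSimplyConnected B) (hAB : IsPathConnected (A ∩ B))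
    (hcov : A ∪ B = Set.univ) : SimplyConnectedSpace Y := by
  classical
  obtain ⟨y₀, h₀A, h₀B⟩ := hAB.nonempty
  have : PathConnectedSpace Y := by
    rw [pathConnectedSpace_iff_univ, ← hcov]
    exact hA.isPathConnected.union hB.isPathConnected hAB.nonempty
  obtain ⟨τA, hτA⟩ := hA.exists_section y₀
  obtain ⟨τB, hτB⟩ := hB.exists_section y₀
  let g : Path.Homotopic.Quotient y₀ y₀ := (τA y₀).trans (τB y₀).symm
  have hglue : ∀ v ∈ A ∩ B, τA v = g.trans (τB v) := by
    intro v hv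
    obtain ⟨p, hp⟩ := hAB.joinedIn y₀ ⟨h₀A, h₀B⟩ v hv
    rw [hτA _ _ p (by rintro _ ⟨t, rfl⟩; exact (hp t).1),
      hτB _ _ p (by rintro _ ⟨t, rfl⟩; exact (hp t).2),
      ← Path.Homotopic.Quotient.trans_assoc]
    congr 1
    simp [g, Path.Homotopic.Quotient.trans_assoc]
  let s : ∀ y, Path.Homotopic.Quotient y₀ y := fun y => if y ∈ A then τA y else g.trans (τB y)
  have hsA : ∀ y ∈ A, s y = τA y := fun y hy => if_pos hy
  have hsB : ∀ y ∈ B, s y = g.trans (τB y) := by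
    intro y hy
    by_cases hyA : y ∈ A
    · rw [hsA y hyA, hglue y ⟨hyA, hy⟩]
    · exact if_neg hyA
  refine simplyConnectedSpace_of_section s fun y => ?_
  rcases (hcov ▸ Set.mem_univ y : y ∈ A ∪ B) with hy | hy
  · refine ⟨A, hAo.mem_nhds hy, fun v w p hp => ?_⟩
    rw [hsA v (by simpa using hp ⟨0, rfl⟩), hsA w (by simpa using hp ⟨1, rfl⟩), hτA _ _ p hp]
  · refine ⟨B, hBo.mem_nhds hy, fun v w p hp => ?_⟩
    rw [hsB v (by simpa using hp ⟨0, rfl⟩), hsB w (by simpa using hp ⟨1, rfl⟩), hτB _ _ p hp]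
    exact (Path.Homotopic.Quotient.trans_assoc _ _ _).symm

/-- Over a simply connected, locally path-connected space every locally constant Čech
`1`-cocycle with values in a group is a coboundary: the covering space that it defines has a
section. -/
theorem exists_coboundary [SimplyConnectedSpace X] [LocallyPathConnectedSpace X] {ι G : Type*}
    [Group G] (B : ι → Set X) (hB : ∀ i, IsOpen (B i)) (idx : X → ι) (hidx : ∀ x, x ∈ B (idx x))
    (c : ι → ι → X → G)
    (hloc : ∀ i j, ∀ x ∈ B i ∩ B j, ∀ᶠ y in 𝓝 x, c i j y = c i j x)
    (hc : ∀ i j k, ∀ x ∈ B i ∩ B j ∩ B k, c j k x * c i j x = c i k x) :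
    ∃ h : ι → X → G, (∀ i, ∀ x ∈ B i, ∀ᶠ y in 𝓝 x, h i y = h i x) ∧
      ∀ i j, ∀ x ∈ B i ∩ B j, c i j x * h i x = h j x := by
  let _ : TopologicalSpace G := ⊥
  have _ : DiscreteTopology G := ⟨rfl⟩
  let Z : FiberBundleCore ι X G :=
    { baseSet := B
      isOpen_baseSet := hB
      indexAt := idx
      mem_baseSet_at := hidx
      coordChange := fun i j x g => c i j x * g
      coordChange_self := fun i x hx v => by
        have := hc i i i x ⟨⟨hx, hx⟩, hx⟩
        rw [mul_eq_left] at this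
        rw [this, one_mul]
      continuousOn_coordChange := fun i j => by
        rintro ⟨x, g⟩ ⟨hx, -⟩
        refine ContinuousAt.continuousWithinAt ?_
        have h1 : ContinuousAt (fun p : X × G => c i j p.1) (x, g) := by
          refine (continuousAt_const (y := c i j x)).congr ?_
          filter_upwards [continuousAt_fst.eventually (hloc i j x hx)] with p hp
          exact hp.symm
        exact h1.mul continuousAt_snd
      coordChange_comp := fun i j k x hx v => by rw [← mul_assoc, hc i j k x hx] }
  have cov : IsCoveringMap (Bundle.TotalSpace.proj : Bundle.TotalSpace G Z.Fiber → X) :=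
    FiberBundle.isCoveringMap
  obtain ⟨x₀⟩ : Nonempty X := inferInstance
  obtain ⟨F, ⟨-, hF⟩, -⟩ := cov.existsUnique_continuousMap_lifts (ContinuousMap.id X) x₀
    (⟨x₀, (1 : G)⟩ : Bundle.TotalSpace G Z.Fiber) rfl
  have hF' : ∀ x, (F x).proj = x := fun x => congrFun hF x
  let u : X → G := fun x => (F x).snd
  have hbase : ∀ i x, ((Z.localTriv i) (F x)).2 = c (idx x) i x * u x := by
    intro i x
    rw [Z.localTriv_apply]
    change c (idx (F x).proj) i (F x).proj * u x = _
    rw [hF']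
  refine ⟨fun i x => ((Z.localTriv i) (F x)).2, fun i x hx => ?_, fun i j x hx => ?_⟩
  · have h1 : ContinuousAt (fun x => ((Z.localTriv i) (F x)).2) x := by
      refine ContinuousAt.snd ?_
      refine ContinuousAt.comp (g := Z.localTriv i) ?_ F.continuous.continuousAt
      refine (Z.localTriv i).continuousAt ?_
      rw [(Z.localTriv i).mem_source]
      have hx' : (F x).proj ∈ B i := by rwa [hF']
      exact hx'
    exact h1.eventually (discreteTopology_iff_singleton_mem_nhds.1 ‹_› _)
  · simp only [hbase]
    rw [← mul_assoc, hc (idx x) i j x ⟨⟨hidx x, hx.1⟩, hx.2⟩]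

/-- If `X` is connected and each point of `X` has arbitrarily small neighbourhoods with
path-connected preimage under `f : Y → X`, then `Y` is path-connected. -/
theorem pathConnectedSpace_of_locally [ConnectedSpace X] (f : Y → X)
    (hloc : ∀ x, ∀ N ∈ 𝓝 x, ∃ B ⊆ N, IsOpen B ∧ x ∈ B ∧ IsPathConnected (f ⁻¹' B)) :
    PathConnectedSpace Y := by
  obtain ⟨x₀⟩ : Nonempty X := inferInstance
  obtain ⟨B₀, -, -, -, hB₀⟩ := hloc x₀ Set.univ Filter.univ_mem
  obtain ⟨y₀, -⟩ := hB₀.nonempty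
  choose B hBN hBo hxB hB using fun x => hloc x Set.univ Filter.univ_mem
  let T : Set X := {x | ∃ y ∈ f ⁻¹' B x, Joined y₀ y}
  have hT : ∀ x, x ∈ T ↔ ∀ y ∈ f ⁻¹' B x, Joined y₀ y := by
    refine fun x => ⟨?_, fun h => ?_⟩
    · rintro ⟨y, hy, hj⟩ z hz
      exact hj.trans ((hB x).joinedIn y hy z hz).joined
    · obtain ⟨y, hy⟩ := (hB x).nonempty
      exact ⟨y, hy, h y hy⟩
  have hmeet : ∀ x, ∀ x' ∈ B x, ∃ y, y ∈ f ⁻¹' B x ∧ y ∈ f ⁻¹' B x' := by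
    intro x x' hx'
    obtain ⟨C, hC, -, -, hCp⟩ := hloc x' (B x ∩ B x')
      (((hBo x).inter (hBo x')).mem_nhds ⟨hx', hxB x'⟩)
    obtain ⟨y, hy⟩ := hCp.nonempty
    exact ⟨y, (hC hy).1, (hC hy).2⟩
  have hTo : IsOpen T := by
    refine isOpen_iff_mem_nhds.2 fun x hx => Filter.mem_of_superset ((hBo x).mem_nhds (hxB x)) ?_
    intro x' hx'
    obtain ⟨y, hy, hy'⟩ := hmeet x x' hx'
    exact ⟨y, hy', (hT x).1 hx y hy⟩
  have hTc : IsClosed T := by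
    rw [← isOpen_compl_iff]
    refine isOpen_iff_mem_nhds.2 fun x hx => Filter.mem_of_superset ((hBo x).mem_nhds (hxB x)) ?_
    intro x' hx' hxT
    obtain ⟨y, hy, hy'⟩ := hmeet x x' hx'
    exact hx ⟨y, hy, (hT x').1 hxT y hy'⟩
  have hTne : f y₀ ∈ T := ⟨y₀, hxB _, Joined.refl _⟩
  have hTu : T = Set.univ := IsClopen.eq_univ ⟨hTc, hTo⟩ ⟨_, hTne⟩
  have hall : ∀ y, Joined y₀ y := fun y =>
    (hT (f y)).1 (hTu ▸ Set.mem_univ _) y (hxB _)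
  exact ⟨⟨y₀⟩, fun x y => (hall x).symm.trans (hall y)⟩

/-- If `X` is simply connected and each point of `X` has arbitrarily small neighbourhoods with
simply connected preimage under `f : Y → X`, then `Y` is simply connected. -/
theorem simplyConnectedSpace_of_locally [SimplyConnectedSpace X] [LocallyPathConnectedSpace X]
    (f : Y → X) (hf : Continuous f)
    (hloc : ∀ x, ∀ N ∈ 𝓝 x, ∃ B ⊆ N, IsOpen B ∧ x ∈ B ∧ IsSimplyConnected (f ⁻¹' B)) :
    SimplyConnectedSpace Y := by
  classical
  have : PathConnectedSpace Y := pathConnectedSpace_of_locally f fun x N hN => by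
    obtain ⟨B, h1, h2, h3, h4⟩ := hloc x N hN
    exact ⟨B, h1, h2, h3, h4.isPathConnected⟩
  obtain ⟨y₀⟩ : Nonempty Y := inferInstance
  choose B hBN hBo hxB hB using fun x => hloc x Set.univ Filter.univ_mem
  choose τ hτ using fun x => (hB x).exists_section y₀
  -- The comparison of two local sections is constant along paths, hence near each point of `X`.
  let d : X → X → Y → FundamentalGroup Y y₀ := fun i j y =>
    FundamentalGroup.fromPath ((τ i y).trans (τ j y).symm)
  have hd : ∀ i j, ∀ x ∈ B i ∩ B j, ∃ C, IsOpen C ∧ x ∈ C ∧ C ⊆ B i ∩ B j ∧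
      (f ⁻¹' C).Nonempty ∧ ∀ v ∈ f ⁻¹' C, ∀ w ∈ f ⁻¹' C, d i j v = d i j w := by
    intro i j x hx
    obtain ⟨C, hC, hCo, hxC, hCp⟩ := hloc x _ (((hBo i).inter (hBo j)).mem_nhds hx)
    refine ⟨C, hCo, hxC, hC, hCp.nonempty, fun v hv w hw => ?_⟩
    obtain ⟨p, hp⟩ := hCp.isPathConnected.joinedIn v hv w hw
    have h1 := hτ i v w p (by rintro _ ⟨t, rfl⟩; exact (hC (hp t)).1)
    have h2 := hτ j v w p (by rintro _ ⟨t, rfl⟩; exact (hC (hp t)).2)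
    change (τ i v).trans (τ j v).symm = (τ i w).trans (τ j w).symm
    rw [h1, h2]
    refine Path.Homotopic.Quotient.trans_right_cancel ((τ j v).trans (.mk p)) ?_
    rw [Path.Homotopic.Quotient.trans_assoc, Path.Homotopic.Quotient.trans_assoc,
      Path.Homotopic.Quotient.symm_trans, Path.Homotopic.Quotient.trans_refl,
      ← Path.Homotopic.Quotient.trans_assoc (τ j v).symm,
      Path.Homotopic.Quotient.symm_trans, Path.Homotopic.Quotient.refl_trans]
  have hne : ∀ x, ∀ N ∈ 𝓝 x, ∃ v, f v ∈ N := fun x N hN => by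
    obtain ⟨C, hC, -, -, hCp⟩ := hloc x N hN
    obtain ⟨v, hv⟩ := hCp.nonempty
    exact ⟨v, hC hv⟩
  have hc : ∀ i j x, ∃ g, x ∈ B i ∩ B j → ∃ C, IsOpen C ∧ x ∈ C ∧ C ⊆ B i ∩ B j ∧
      ∀ v ∈ f ⁻¹' C, d i j v = g := by
    intro i j x
    by_cases hx : x ∈ B i ∩ B j
    · obtain ⟨C, hCo, hxC, hCB, ⟨v, hv⟩, hCd⟩ := hd i j x hx
      exact ⟨d i j v, fun _ => ⟨C, hCo, hxC, hCB, fun w hw => hCd w hw v hv⟩⟩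
    · exact ⟨1, fun h => absurd h hx⟩
  choose c hc using hc
  obtain ⟨h, hh, hhc⟩ := exists_coboundary B hBo id hxB c
    (by
      intro i j x hx
      obtain ⟨C, hCo, hxC, hCB, hC⟩ := hc i j x hx
      filter_upwards [hCo.mem_nhds hxC] with y hy
      obtain ⟨C', hCo', hyC', -, hC'⟩ := hc i j y (hCB hy)
      obtain ⟨v, hv, hv'⟩ := hne y (C ∩ C') ((hCo.inter hCo').mem_nhds ⟨hy, hyC'⟩)
      rw [← hC v hv, ← hC' v hv'])
    (by
      intro i j k x hx
      obtain ⟨C₁, ho₁, hx₁, -, h₁⟩ := hc i j x hx.1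
      obtain ⟨C₂, ho₂, hx₂, -, h₂⟩ := hc j k x ⟨hx.1.2, hx.2⟩
      obtain ⟨C₃, ho₃, hx₃, -, h₃⟩ := hc i k x ⟨hx.1.1, hx.2⟩
      obtain ⟨v, ⟨hv₁, hv₂⟩, hv₃⟩ := hne x (C₁ ∩ C₂ ∩ C₃)
        (((ho₁.inter ho₂).inter ho₃).mem_nhds ⟨⟨hx₁, hx₂⟩, hx₃⟩)
      rw [← h₁ v hv₁, ← h₂ v hv₂, ← h₃ v hv₃]
      change ((τ i v).trans (τ j v).symm).trans ((τ j v).trans (τ k v).symm) =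
        (τ i v).trans (τ k v).symm
      rw [Path.Homotopic.Quotient.trans_assoc, ← Path.Homotopic.Quotient.trans_assoc (τ j v).symm,
        Path.Homotopic.Quotient.symm_trans, Path.Homotopic.Quotient.refl_trans])
  let σ : X → ∀ y, Path.Homotopic.Quotient y₀ y := fun i y =>
    (FundamentalGroup.toPath (h i (f y))).trans (τ i y)
  have hσ : ∀ i j y, f y ∈ B i ∩ B j → σ i y = σ j y := by
    intro i j y hy
    obtain ⟨C, -, hxC, -, hC⟩ := hc i j (f y) hy
    have h1 := hhc i j (f y) hy
    rw [← hC y hxC] at h1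
    change (FundamentalGroup.toPath (h i (f y))).trans ((τ i y).trans (τ j y).symm) = _ at h1
    change (FundamentalGroup.toPath (h i (f y))).trans (τ i y) =
      (FundamentalGroup.toPath (h j (f y))).trans (τ j y)
    refine Eq.trans ?_ (congrArg (fun a => Path.Homotopic.Quotient.trans a (τ j y)) h1)
    rw [Path.Homotopic.Quotient.trans_assoc, Path.Homotopic.Quotient.trans_assoc,
      Path.Homotopic.Quotient.symm_trans, Path.Homotopic.Quotient.trans_refl]
  refine simplyConnectedSpace_of_section (fun y => σ (f y) y) fun y => ?_
  refine ⟨f ⁻¹' (B (f y) ∩ {x | h (f y) x = h (f y) (f y)}), hf.continuousAt.preimage_mem_nhds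
    (Filter.inter_mem ((hBo _).mem_nhds (hxB _)) (hh _ _ (hxB _))), fun v w p hp => ?_⟩
  have hv : f v ∈ B (f y) ∩ {x | h (f y) x = h (f y) (f y)} := by simpa using hp ⟨0, rfl⟩
  have hw : f w ∈ B (f y) ∩ {x | h (f y) x = h (f y) (f y)} := by simpa using hp ⟨1, rfl⟩
  rw [hσ (f v) (f y) v ⟨hxB _, hv.1⟩, hσ (f w) (f y) w ⟨hxB _, hw.1⟩]
  have e1 : h (f y) (f v) = h (f y) (f w) := hv.2.trans hw.2.symm
  simp only [σ]
  rw [hτ (f y) v w p (hp.trans fun _ hx => hx.1), e1, Path.Homotopic.Quotient.trans_assoc]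

end PathSections

/-! ### Complements of locally flat subsets -/

section LocallyFlat

theorem isSimplyConnected_preimage_val {X : Type*} [TopologicalSpace X] {s t : Set X}
    (h : IsSimplyConnected s) (hst : s ⊆ t) : IsSimplyConnected ((↑) ⁻¹' s : Set t) := by
  rw [← (Topology.IsEmbedding.subtypeVal).isSimplyConnected_image, Subtype.image_preimage_val,
    Set.inter_eq_right.2 hst]
  exact h

theorem isPathConnected_preimage_val {X : Type*} [TopologicalSpace X] {s t : Set X}
    (h : IsPathConnected s) (hst : s ⊆ t) : IsPathConnected ((↑) ⁻¹' s : Set t) := by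
  rw [Topology.IsInducing.subtypeVal.isPathConnected_iff, Subtype.image_preimage_val,
    Set.inter_eq_right.2 hst]
  exact h

theorem StarConvex.isSimplyConnected {F : Type*} [AddCommGroup F] [Module ℝ F]
    [TopologicalSpace F] [ContinuousAdd F] [ContinuousSMul ℝ F] {s : Set F} {x : F}
    (h : StarConvex ℝ x s) (hx : x ∈ s) : IsSimplyConnected s := by
  have := h.contractibleSpace ⟨x, hx⟩
  exact SimplyConnectedSpace.ofContractible s

variable {E : Type*} [NormedAddCommGroup E] [NormedSpace ℝ E] [FiniteDimensional ℝ E]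

/-- The complement of a linear subspace of real codimension at least `3` is simply connected.
For a vector `v` outside the subspace `L`, it is the union of the complements of the two closed
half spaces of `L ⊔ ℝ v` with boundary `L`; these are star-shaped about `v` and `-v`, and they meet
in the complement of `L ⊔ ℝ v`. -/
theorem isSimplyConnected_compl_submodule (L : Submodule ℝ E)
    (hL : 3 ≤ Module.finrank ℝ (E ⧸ L)) : IsSimplyConnected ((L : Set E)ᶜ) := by
  obtain ⟨v, hv⟩ : ∃ v, v ∉ L := by
    by_contra! h
    obtain rfl : L = ⊤ := (Submodule.eq_top_iff').2 h
    have := Module.finrank_zero_of_subsingleton (R := ℝ) (M := E ⧸ (⊤ : Submodule ℝ E))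
    omega
  obtain ⟨ℓ₀, hℓ₀v, hℓ₀L⟩ := Submodule.exists_le_ker_of_notMem hv
  let ℓ : E →ₗ[ℝ] ℝ := (ℓ₀ v)⁻¹ • ℓ₀
  have hℓv : ℓ v = 1 := by simp [ℓ, hℓ₀v]
  have hℓL : ∀ y ∈ L, ℓ y = 0 := fun y hy => by
    have : ℓ₀ y = 0 := hℓ₀L hy
    simp [ℓ, this]
  let π : E →ₗ[ℝ] E := LinearMap.id - ℓ.smulRight v
  have hπ : ∀ y, π y = y - ℓ y • v := fun y => by simp [π]
  have hπv : π v = 0 := by simp [hπ, hℓv]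
  have hLc : IsClosed (L : Set E) := L.closed_of_finiteDimensional
  have hℓc : Continuous ℓ := ℓ.continuous_of_finiteDimensional
  have hπc : Continuous π := π.continuous_of_finiteDimensional
  -- `π` projects along `v`, so `π y ∉ L` means that `y` lies off `L ⊔ ℝ v`
  have key : ∀ σ : ℝ, σ = 1 ∨ σ = -1 →
      IsOpen {y | π y ∉ L ∨ 0 < σ * ℓ y} ∧ IsSimplyConnected {y | π y ∉ L ∨ 0 < σ * ℓ y} := by
    intro σ hσ
    have hσσ : σ * σ = 1 := by rcases hσ with rfl | rfl <;> norm_num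
    refine ⟨(hLc.isOpen_compl.preimage hπc).union
      (isOpen_lt continuous_const (continuous_const.mul hℓc)), ?_⟩
    refine StarConvex.isSimplyConnected (x := σ • v) ?_ (Or.inr (by simp [hℓv, hσσ]))
    intro y hy a b ha hb hab
    have e1 : π (a • σ • v + b • y) = b • π y := by simp [hπv]
    have e2 : σ * ℓ (a • σ • v + b • y) = a + b * (σ * ℓ y) := by
      simp only [map_add, map_smul, hℓv, smul_eq_mul, mul_one]
      linear_combination a * hσσ
    rw [Set.mem_ofPred_eq, e1, e2]
    rcases hy with hy | hy
    · rcases hb.eq_or_lt with rfl | hb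
      · right; simp only [add_zero] at hab; simp [hab]
      · left; rwa [L.smul_mem_iff hb.ne']
    · right
      rcases ha.eq_or_lt with rfl | ha
      · simp only [zero_add] at hab; simpa [hab] using hy
      · have := mul_nonneg hb hy.le; linarith
  obtain ⟨hAo, hA⟩ := key 1 (Or.inl rfl)
  obtain ⟨hBo, hB⟩ := key (-1) (Or.inr rfl)
  have hsub : ∀ σ : ℝ, {y | π y ∉ L ∨ 0 < σ * ℓ y} ⊆ (L : Set E)ᶜ := by
    rintro σ y (hy | hy) hyL
    · rw [hπ, hℓL y hyL, zero_smul, sub_zero] at hy; exact hy hyL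
    · rw [hℓL y hyL] at hy; simp at hy
  have hinter : {y | π y ∉ L ∨ 0 < 1 * ℓ y} ∩ {y | π y ∉ L ∨ 0 < -1 * ℓ y}
      = ((L.comap π : Submodule ℝ E) : Set E)ᶜ := by
    ext y
    simp only [Set.mem_inter_iff, Set.mem_ofPred_eq, Set.mem_compl_iff, SetLike.mem_coe,
      Submodule.mem_comap]
    constructor
    · rintro ⟨h1 | h1, h2 | h2⟩ <;> first | assumption | (exfalso; linarith)
    · exact fun h => ⟨Or.inl h, Or.inl h⟩
  have hpc : IsPathConnected ({y | π y ∉ L ∨ 0 < 1 * ℓ y} ∩ {y | π y ∉ L ∨ 0 < -1 * ℓ y}) := by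
    rw [hinter]
    refine isPathConnected_compl_of_one_lt_codim ?_
    have hle : L.comap π ≤ L ⊔ Submodule.span ℝ {v} := by
      intro y hy
      have : y = π y + ℓ y • v := by rw [hπ]; abel
      rw [this]
      exact Submodule.add_mem_sup hy (Submodule.smul_mem _ _ (Submodule.mem_span_singleton_self v))
    have h1 := Submodule.finrank_mono hle
    have h2 := Submodule.finrank_add_le_finrank_add_finrank L (Submodule.span ℝ {v})
    have h3 := finrank_span_singleton (K := ℝ) (v := v) (by rintro rfl; exact hv L.zero_mem)
    have h4 := Submodule.finrank_quotient_add_finrank L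
    have h5 := Submodule.finrank_quotient_add_finrank (L.comap π)
    rw [← Module.finrank_eq_rank]
    norm_cast
    omega
  refine simplyConnectedSpace_of_union (A := (↑) ⁻¹' {y | π y ∉ L ∨ 0 < 1 * ℓ y})
    (B := (↑) ⁻¹' {y | π y ∉ L ∨ 0 < -1 * ℓ y}) (hAo.preimage continuous_subtype_val)
    (hBo.preimage continuous_subtype_val) (isSimplyConnected_preimage_val hA (hsub 1))
    (isSimplyConnected_preimage_val hB (hsub (-1))) ?_ ?_
  · rw [← Set.preimage_inter]
    exact isPathConnected_preimage_val hpc (Set.inter_subset_left.trans (hsub 1))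
  · refine Set.eq_univ_of_forall fun ⟨y, hy⟩ => ?_
    simp only [Set.mem_union, Set.mem_preimage, Set.mem_ofPred_eq]
    by_cases h : π y ∈ L
    · have h0 : ℓ y ≠ 0 := by
        intro h0; rw [hπ, h0, zero_smul, sub_zero] at h; exact hy h
      rcases h0.lt_or_gt with h1 | h1
      · right; right; linarith
      · left; right; linarith
    · exact Or.inl (Or.inl h)

omit [FiniteDimensional ℝ E] in
/-- Around each point of a space with a chart there are arbitrarily small charts onto the whole
model space which are radial reparametrizations of the given one. -/
theorem OpenPartialHomeomorph.exists_radial {X : Type*} [TopologicalSpace X]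
    (e : OpenPartialHomeomorph X E) {x : X} (hx : x ∈ e.source) {N : Set X} (hN : N ∈ 𝓝 x) :
    ∃ e' : OpenPartialHomeomorph X E, x ∈ e'.source ∧ e'.source ⊆ e.source ∩ N ∧
      e'.target = Set.univ ∧ ∀ y ∈ e'.source, ∃ c : ℝ, c ≠ 0 ∧ e y - e x = c • e' y := by
  have h1 : e.target ∩ e.symm ⁻¹' N ∈ 𝓝 (e x) := by
    refine Filter.inter_mem (e.open_target.mem_nhds (e.map_source hx)) ?_
    refine (e.continuousAt_symm (e.map_source hx)).preimage_mem_nhds ?_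
    rwa [e.left_inv hx]
  obtain ⟨r, hr, hball⟩ := Metric.mem_nhds_iff.1 h1
  let b : OpenPartialHomeomorph E E := OpenPartialHomeomorph.univBall (e x) r
  have hbs : b.source = Set.univ := OpenPartialHomeomorph.univBall_source _ _
  have hbt : b.target = Metric.ball (e x) r := OpenPartialHomeomorph.univBall_target _ hr
  have hb : ∀ z, ∃ c : ℝ, c ≠ 0 ∧ b z - e x = c • z := by
    intro z
    refine ⟨r * (√(1 + ‖z‖ ^ 2))⁻¹, by positivity, ?_⟩
    have : b z = r • ((√(1 + ‖z‖ ^ 2))⁻¹ • z) + e x := by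
      simp only [b, OpenPartialHomeomorph.univBall, dif_pos hr]
      rfl
    rw [this, add_sub_cancel_right, smul_smul]
  refine ⟨e.trans b.symm, ?_, ?_, ?_, ?_⟩
  · rw [OpenPartialHomeomorph.trans_source]
    refine ⟨hx, ?_⟩
    rw [b.symm_source, hbt]
    exact Metric.mem_ball_self hr
  · rw [OpenPartialHomeomorph.trans_source, b.symm_source, hbt]
    rintro y ⟨hy, hyb⟩
    refine ⟨hy, ?_⟩
    have := (hball hyb).2
    rwa [Set.mem_preimage, e.left_inv hy] at this
  · rw [OpenPartialHomeomorph.trans_target, b.symm_target, hbs, Set.univ_inter]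
    refine Set.eq_univ_of_forall fun z => (hball ?_).1
    rw [← hbt]
    exact b.map_source (hbs ▸ Set.mem_univ z)
  · rintro y hy
    rw [OpenPartialHomeomorph.trans_source, b.symm_source] at hy
    obtain ⟨c, hc, h⟩ := hb (b.symm (e y))
    rw [b.right_inv hy.2] at h
    exact ⟨c, hc, h⟩

/-- `A` is locally flat of real codimension at least `k`: around each of its points some
topological chart of `X` identifies it with an affine subspace of codimension at least `k`. -/
def IsLocallyFlat (E : Type*) {X : Type*} [NormedAddCommGroup E] [NormedSpace ℝ E]
    [TopologicalSpace X] (k : ℕ) (A : Set X) : Prop :=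
  ∀ x ∈ A, ∃ e : OpenPartialHomeomorph X E, x ∈ e.source ∧
    ∃ L : Submodule ℝ E, k ≤ Module.finrank ℝ (E ⧸ L) ∧ ∀ y ∈ e.source, y ∈ A ↔ e y - e x ∈ L

variable {X : Type*} [TopologicalSpace X] [ChartedSpace E X]

omit [FiniteDimensional ℝ E] in
/-- Each point has arbitrarily small open neighbourhoods `B` such that `B \ A` is homeomorphic to
the model space or to the complement of a linear subspace in it. -/
theorem IsLocallyFlat.exists_nhds {k : ℕ} {A : Set X} (hA : IsLocallyFlat E k A)
    (hAc : IsClosed A) (x : X) {N : Set X} (hN : N ∈ 𝓝 x) :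
    ∃ B ⊆ N, IsOpen B ∧ x ∈ B ∧ ∃ g : E → X, Topology.IsEmbedding g ∧
      (B ∩ Aᶜ = Set.range g ∨ ∃ L : Submodule ℝ E, k ≤ Module.finrank ℝ (E ⧸ L) ∧
        B ∩ Aᶜ = g '' (L : Set E)ᶜ) := by
  by_cases hx : x ∈ A
  · obtain ⟨e, hxe, L, hL, heL⟩ := hA x hx
    obtain ⟨e', hxe', hsub, htar, hrad⟩ := e.exists_radial hxe hN
    refine ⟨e'.source, hsub.trans Set.inter_subset_right, e'.open_source, hxe', e'.symm,
      (e'.symm.isOpenEmbedding htar).isEmbedding, Or.inr ⟨L, hL, ?_⟩⟩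
    have hmem : ∀ y ∈ e'.source, y ∈ A ↔ e' y ∈ L := fun y hy => by
      obtain ⟨c, hc, h⟩ := hrad y hy
      rw [heL y (hsub hy).1, h, L.smul_mem_iff hc]
    ext y
    constructor
    · rintro ⟨hy, hyA⟩
      exact ⟨e' y, fun h => hyA ((hmem y hy).2 h), e'.left_inv hy⟩
    · rintro ⟨z, hz, rfl⟩
      have hz' : z ∈ e'.target := htar ▸ Set.mem_univ z
      refine ⟨e'.map_target hz', fun h => hz ?_⟩
      have := (hmem _ (e'.map_target hz')).1 h
      rwa [e'.right_inv hz'] at this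
  · obtain ⟨e', hxe', hsub, htar, -⟩ := (chartAt E x).exists_radial (mem_chart_source E x)
      (Filter.inter_mem hN (hAc.isOpen_compl.mem_nhds hx))
    refine ⟨e'.source, fun y hy => (hsub hy).2.1, e'.open_source, hxe', e'.symm,
      (e'.symm.isOpenEmbedding htar).isEmbedding, Or.inl ?_⟩
    rw [Set.inter_eq_left.2 fun y hy => (hsub hy).2.2, ← e'.symm_image_target_eq_source, htar,
      Set.image_univ]

omit [FiniteDimensional ℝ E] in
theorem IsLocallyFlat.isPathConnected_compl [ConnectedSpace X] {A : Set X}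
    (hA : IsLocallyFlat E 2 A) (hAc : IsClosed A) : IsPathConnected Aᶜ := by
  rw [isPathConnected_iff_pathConnectedSpace]
  refine pathConnectedSpace_of_locally (X := X) (Subtype.val : ↥Aᶜ → X) fun x N hN => ?_
  obtain ⟨B, hBN, hBo, hxB, g, hg, h⟩ := hA.exists_nhds hAc x hN
  refine ⟨B, hBN, hBo, hxB, ?_⟩
  rw [← Subtype.preimage_coe_inter_self]
  refine isPathConnected_preimage_val ?_ Set.inter_subset_right
  rcases h with h | ⟨L, hL, h⟩
  · rw [h]; exact isPathConnected_range hg.continuous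
  · rw [h]
    refine (isPathConnected_compl_of_one_lt_codim ?_).image hg.continuous
    have : FiniteDimensional ℝ (E ⧸ L) := Module.finite_of_finrank_pos (by omega)
    rw [← Module.finrank_eq_rank]
    norm_cast

/-- The complement of a closed locally flat subset of codimension at least `3` in a simply
connected manifold is simply connected. -/
theorem IsLocallyFlat.isSimplyConnected_compl [SimplyConnectedSpace X] {A : Set X}
    (hA : IsLocallyFlat E 3 A) (hAc : IsClosed A) : IsSimplyConnected Aᶜ := by
  have := ChartedSpace.locallyPathConnectedSpace E X
  refine simplyConnectedSpace_of_locally (X := X) (Subtype.val : ↥Aᶜ → X) continuous_subtype_val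
    fun x N hN => ?_
  obtain ⟨B, hBN, hBo, hxB, g, hg, h⟩ := hA.exists_nhds hAc x hN
  refine ⟨B, hBN, hBo, hxB, ?_⟩
  rw [← Subtype.preimage_coe_inter_self]
  refine isSimplyConnected_preimage_val ?_ Set.inter_subset_right
  rcases h with h | ⟨L, hL, h⟩
  · rw [h, ← Set.image_univ, hg.isSimplyConnected_image]
    exact StarConvex.isSimplyConnected (x := 0) (convex_univ.starConvex (Set.mem_univ _))
      (Set.mem_univ _)
  · rw [h, hg.isSimplyConnected_image]
    exact isSimplyConnected_compl_submodule L hL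

end LocallyFlat

/-! ### Topological ping-pong -/

/-- The element of the group that a letter of the alphabet `α ∪ α⁻¹` stands for, when the letters
of `α` stand for the elements `gen a`. -/
def letter {G α : Type*} [Group G] (gen : α → G) (s : α × Bool) : G :=
  cond s.2 (gen s.1) (gen s.1)⁻¹

/-- The inverse letter. -/
def letterInv {α : Type*} (s : α × Bool) : α × Bool := (s.1, !s.2)

/-- Ping-pong on a topological space: each letter `s` has a nonempty open set `B s`, the `B s` have
disjoint closures, and `s` maps the complement of `B s⁻¹` onto the closure of `B s`. -/
structure IsPingPong {G X α : Type*} [Group G] [MulAction G X] [TopologicalSpace X]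
    (gen : α → G) (B : α × Bool → Set X) : Prop where
  isOpen : ∀ s, IsOpen (B s)
  nonempty : ∀ s, (B s).Nonempty
  disjoint : ∀ s t, s ≠ t → Disjoint (closure (B s)) (closure (B t))
  smul_mem_closure : ∀ s x, letter gen s • x ∈ closure (B s) ↔ x ∉ B (letterInv s)

section PingPong

variable {G X α : Type*} [Group G] [MulAction G X] [TopologicalSpace X]
  {gen : α → G} {B : α × Bool → Set X}

theorem letterInv_letterInv (s : α × Bool) : letterInv (letterInv s) = s := by
  simp [letterInv]

theorem letterInv_ne (s : α × Bool) : letterInv s ≠ s := by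
  rcases s with ⟨a, _ | _⟩ <;> simp [letterInv]

theorem letter_letterInv (s : α × Bool) : letter gen (letterInv s) = (letter gen s)⁻¹ := by
  rcases s with ⟨a, _ | _⟩ <;> simp [letter, letterInv]

theorem lift_mk_cons (s : α × Bool) (L : List (α × Bool)) :
    FreeGroup.lift gen (FreeGroup.mk (s :: L)) =
      letter gen s * FreeGroup.lift gen (FreeGroup.mk L) := by
  simp [letter]

theorem isReduced_cons_cons_iff {s t : α × Bool} {L : List (α × Bool)} :
    FreeGroup.IsReduced (s :: t :: L) ↔ t ≠ letterInv s ∧ FreeGroup.IsReduced (t :: L) := by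
  rw [FreeGroup.isReduced_cons_cons]
  refine and_congr_left fun _ => ?_
  rcases s with ⟨a, _ | _⟩ <;> rcases t with ⟨b, _ | _⟩ <;> simp [letterInv, eq_comm]

/-- The set `s₁ ⋯ sₙ (B sₙ₊₁)` belonging to the word `s₁ ⋯ sₙ₊₁`. -/
def nest (gen : α → G) (B : α × Bool → Set X) : List (α × Bool) → Set X
  | [] => Set.univ
  | [s] => B s
  | s :: t :: L => {x | (letter gen s)⁻¹ • x ∈ nest gen B (t :: L)}

/-- The complement of the union of the sets `nest gen B L` for the reduced words `L` of
length `n + 1`. -/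
def level (gen : α → G) (B : α × Bool → Set X) (n : ℕ) : Set X :=
  {x | ∀ L : List (α × Bool), FreeGroup.IsReduced L → L.length = n + 1 → x ∉ nest gen B L}

omit [TopologicalSpace X] in
theorem mem_level_zero {x : X} : x ∈ level gen B 0 ↔ ∀ s, x ∉ B s := by
  refine ⟨fun h s => h [s] FreeGroup.IsReduced.singleton rfl, fun h L _ hL => ?_⟩
  obtain ⟨s, rfl⟩ := List.length_eq_one_iff.1 hL
  exact h s

namespace IsPingPong

theorem smul_mem (P : IsPingPong gen B) (s : α × Bool) (x : X) :
    letter gen s • x ∈ B s ↔ x ∉ closure (B (letterInv s)) := by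
  have h := P.smul_mem_closure (letterInv s) (letter gen s • x)
  rw [letter_letterInv, inv_smul_smul, letterInv_letterInv] at h
  rw [h, not_not]

theorem inv_smul_mem (P : IsPingPong gen B) (s : α × Bool) (x : X) :
    (letter gen s)⁻¹ • x ∉ closure (B (letterInv s)) ↔ x ∈ B s := by
  rw [← P.smul_mem, smul_inv_smul]

/-- A letter `s` maps the closures of the sets of all letters but `s⁻¹` into `B s`. -/
theorem smul_mem_of_ne (P : IsPingPong gen B) {s t : α × Bool} (hst : t ≠ letterInv s) {x : X}
    (hx : x ∈ closure (B t)) : letter gen s • x ∈ B s :=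
  (P.smul_mem s x).2 fun h => Set.disjoint_left.1 (P.disjoint _ _ hst) hx h

variable [ContinuousConstSMul G X]

theorem closure_nest_cons_cons (s t : α × Bool) (L : List (α × Bool)) :
    closure (nest gen B (s :: t :: L)) =
      {x | (letter gen s)⁻¹ • x ∈ closure (nest gen B (t :: L))} :=
  ((Homeomorph.smul (letter gen s)⁻¹).preimage_closure _).symm

theorem isOpen_nest (P : IsPingPong gen B) : ∀ L, IsOpen (nest gen B L)
  | [] => isOpen_univ
  | [s] => P.isOpen s
  | _ :: t :: L => (P.isOpen_nest (t :: L)).preimage (continuous_const_smul _)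

theorem closure_nest_subset (P : IsPingPong gen B) : ∀ (L : List (α × Bool)) (s : α × Bool),
    FreeGroup.IsReduced (s :: L) → closure (nest gen B (s :: L)) ⊆ closure (B s)
  | [], _, _ => subset_rfl
  | t :: L, s, h => by
    obtain ⟨hst, hL⟩ := isReduced_cons_cons_iff.1 h
    rw [closure_nest_cons_cons]
    intro x hx
    have := P.smul_mem_of_ne hst (P.closure_nest_subset L t hL hx)
    rw [smul_inv_smul] at this
    exact subset_closure this

theorem nest_subset (P : IsPingPong gen B) {s : α × Bool} {L : List (α × Bool)}
    (h : FreeGroup.IsReduced (s :: L)) : nest gen B (s :: L) ⊆ B s := by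
  cases L with
  | nil => exact subset_rfl
  | cons t L =>
    obtain ⟨hst, hL⟩ := isReduced_cons_cons_iff.1 h
    intro x hx
    have := P.smul_mem_of_ne hst (P.closure_nest_subset L t hL (subset_closure hx))
    rwa [smul_inv_smul] at this

/-- The sets of different reduced words of equal length have disjoint closures. -/
theorem disjoint_closure_nest (P : IsPingPong gen B) : ∀ (L L' : List (α × Bool)),
    FreeGroup.IsReduced L → FreeGroup.IsReduced L' → L.length = L'.length → L ≠ L' →
    Disjoint (closure (nest gen B L)) (closure (nest gen B L'))
  | [], [], _, _, _, hne => absurd rfl hne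
  | [], _ :: _, _, _, h, _ => by simp at h
  | _ :: _, [], _, _, h, _ => by simp at h
  | s :: L, s' :: L', hL, hL', hlen, hne => by
    by_cases hs : s = s'
    · subst hs
      have hne' : L ≠ L' := fun h => hne (by rw [h])
      match L, L' with
      | [], [] => exact absurd rfl hne'
      | [], _ :: _ => simp at hlen
      | _ :: _, [] => simp at hlen
      | t :: L, t' :: L' =>
        rw [closure_nest_cons_cons, closure_nest_cons_cons]
        exact (P.disjoint_closure_nest (t :: L) (t' :: L') (isReduced_cons_cons_iff.1 hL).2
          (isReduced_cons_cons_iff.1 hL').2 (by simpa using hlen) hne').preimage _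
    · exact (P.disjoint s s' hs).mono (P.closure_nest_subset L s hL)
        (P.closure_nest_subset L' s' hL')

theorem closure_nest_append_subset (P : IsPingPong gen B) : ∀ (L : List (α × Bool))
    (s t : α × Bool), FreeGroup.IsReduced (s :: L ++ [t]) →
    closure (nest gen B (s :: L ++ [t])) ⊆ nest gen B (s :: L)
  | [], s, t, h => by
    obtain ⟨hst, -⟩ := isReduced_cons_cons_iff.1 h
    intro x hx
    rw [List.cons_append, List.nil_append, closure_nest_cons_cons] at hx
    have := P.smul_mem_of_ne hst hx
    rwa [smul_inv_smul] at this
  | u :: L, s, t, h => by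
    obtain ⟨-, hL⟩ := isReduced_cons_cons_iff.1 h
    intro x hx
    have hx' : x ∈ closure (nest gen B (s :: u :: (L ++ [t]))) := hx
    rw [closure_nest_cons_cons] at hx'
    exact P.closure_nest_append_subset L u t hL hx'

theorem isClosed_level (P : IsPingPong gen B) (n : ℕ) : IsClosed (level gen B n) := by
  simp only [level, Set.ofPred_forall]
  exact isClosed_iInter fun L => isClosed_iInter fun _ => isClosed_iInter fun _ =>
    (P.isOpen_nest L).isClosed_compl

theorem finite_words [Finite α] (n : ℕ) :
    {L : List (α × Bool) | FreeGroup.IsReduced L ∧ L.length = n}.Finite :=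
  (List.finite_length_eq (α × Bool) n).subset fun _ h => h.2

theorem level_subset_interior [Finite α] (P : IsPingPong gen B) (n : ℕ) :
    level gen B n ⊆ interior (level gen B (n + 1)) := by
  have hfin := finite_words (α := α) (n + 2)
  have hcl : IsClosed (⋃ L ∈ {L : List (α × Bool) | FreeGroup.IsReduced L ∧ L.length = n + 2},
      closure (nest gen B L)) := hfin.isClosed_biUnion fun _ _ => isClosed_closure
  refine Set.Subset.trans ?_ (interior_maximal ?_ hcl.isOpen_compl)
  · intro x hx hx'
    simp only [Set.mem_iUnion] at hx'
    obtain ⟨L, ⟨hL, hlen⟩, hxL⟩ := hx'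
    rcases List.eq_nil_or_concat' L with rfl | ⟨L', t, rfl⟩
    · simp at hlen
    · cases L' with
      | nil => simp at hlen
      | cons s L' =>
        refine hx (s :: L') ?_ (by simpa using hlen) (P.closure_nest_append_subset L' s t hL hxL)
        exact hL.infix (List.prefix_append _ _).isInfix
  · intro x hx L hL hlen hxL
    exact hx (Set.mem_biUnion (show L ∈ {L | _} from ⟨hL, hlen⟩) (subset_closure hxL))

theorem level_mono [Finite α] (P : IsPingPong gen B) : Monotone (level gen B) :=
  monotone_nat_of_le_succ fun n => (P.level_subset_interior n).trans interior_subset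

/-- Peeling off the first letter: a point of level `n + 1` lies in level `0` or is the image of a
point of level `n` under a letter. -/
theorem mem_level_succ (P : IsPingPong gen B) {n : ℕ} {x : X} (hx : x ∈ level gen B (n + 1)) :
    x ∈ level gen B 0 ∨ ∃ s, (letter gen s)⁻¹ • x ∈ level gen B n := by
  by_cases h0 : x ∈ level gen B 0
  · exact Or.inl h0
  rw [mem_level_zero] at h0
  push Not at h0
  obtain ⟨s, hs⟩ := h0
  refine Or.inr ⟨s, fun L hL hlen hxL => ?_⟩
  cases L with
  | nil => simp at hlen
  | cons t L =>
    by_cases ht : t = letterInv s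
    · subst ht
      exact (P.inv_smul_mem s x).2 hs (subset_closure (P.nest_subset hL hxL))
    · exact hx (s :: t :: L) (isReduced_cons_cons_iff.2 ⟨ht, hL⟩) (by simpa using hlen) hxL

theorem smul_level_subset [Finite α] (P : IsPingPong gen B) (s : α × Bool) {n : ℕ} {x : X}
    (hx : x ∈ level gen B n) : letter gen s • x ∈ level gen B (n + 1) := by
  intro L hL hlen hxL
  match L with
  | [] => simp at hlen
  | [_] => simp at hlen
  | t :: u :: L =>
    by_cases hts : t = s
    · subst hts
      simp only [nest, Set.mem_ofPred_eq, inv_smul_smul] at hxL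
      exact hx (u :: L) (isReduced_cons_cons_iff.1 hL).2 (by simpa using hlen) hxL
    · refine P.level_mono (show n ≤ n + 2 by omega) hx (letterInv s :: t :: u :: L)
        (isReduced_cons_cons_iff.2 ⟨by rwa [letterInv_letterInv], hL⟩)
        (by simpa using hlen) ?_
      simp only [nest, letter_letterInv, inv_inv]
      exact hxL

/-- The union of the levels is the union of the translates of level `0` under the group generated
by the `gen a`. -/
theorem iUnion_level [Finite α] (P : IsPingPong gen B) (x : X) :
    (∃ n, x ∈ level gen B n) ↔
      ∃ w : FreeGroup α, (FreeGroup.lift gen w)⁻¹ • x ∈ level gen B 0 := by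
  constructor
  · rintro ⟨n, hx⟩
    induction n generalizing x with
    | zero => exact ⟨1, by simpa using hx⟩
    | succ n ih =>
      rcases P.mem_level_succ hx with h | ⟨s, hs⟩
      · exact ⟨1, by simpa using h⟩
      · obtain ⟨w, hw⟩ := ih _ hs
        refine ⟨FreeGroup.mk [s] * w, ?_⟩
        rw [map_mul, lift_mk_cons, ← FreeGroup.one_eq_mk, map_one, mul_one, mul_inv_rev, mul_smul]
        exact hw
  · rintro ⟨w, hw⟩
    obtain ⟨y, hy, rfl⟩ : ∃ y, y ∈ level gen B 0 ∧ FreeGroup.lift gen w • y = x :=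
      ⟨_, hw, smul_inv_smul _ _⟩
    classical
    rw [← FreeGroup.mk_toWord (x := w)]
    generalize w.toWord = L
    clear hw
    induction L with
    | nil => exact ⟨0, by simpa [← FreeGroup.one_eq_mk] using hy⟩
    | cons s L ih =>
      obtain ⟨n, hn⟩ := ih
      refine ⟨n + 1, ?_⟩
      rw [lift_mk_cons, mul_smul]
      exact P.smul_level_subset s hn

omit [ContinuousConstSMul G X] in
/-- A reduced word moves level `0` into the closure of the set of its first letter. -/
theorem lift_smul_mem_closure (P : IsPingPong gen B) {x : X} (hx : x ∈ level gen B 0) :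
    ∀ (L : List (α × Bool)) (s : α × Bool), FreeGroup.IsReduced (s :: L) →
      FreeGroup.lift gen (FreeGroup.mk (s :: L)) • x ∈ closure (B s)
  | [], s, _ => by
    rw [lift_mk_cons, ← FreeGroup.one_eq_mk, map_one, mul_one, P.smul_mem_closure]
    exact mem_level_zero.1 hx _
  | t :: L, s, h => by
    obtain ⟨hst, hL⟩ := isReduced_cons_cons_iff.1 h
    rw [lift_mk_cons, mul_smul]
    exact subset_closure (P.smul_mem_of_ne hst (P.lift_smul_mem_closure hx L t hL))

omit [ContinuousConstSMul G X] in
/-- A word that maps a point of level `0` to a point of level `0` has length at most one. -/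
theorem eq_one_or_letter (P : IsPingPong gen B) {x : X} (hx : x ∈ level gen B 0)
    {w : FreeGroup α} (hw : FreeGroup.lift gen w • x ∈ level gen B 0) :
    w = 1 ∨ ∃ s, w = FreeGroup.mk [s] := by
  classical
  have hred : FreeGroup.IsReduced w.toWord := FreeGroup.isReduced_toWord
  have hmk : FreeGroup.mk w.toWord = w := FreeGroup.mk_toWord
  revert hred hmk
  match w.toWord with
  | [] => intro _ hmk; exact Or.inl (hmk.symm.trans FreeGroup.one_eq_mk.symm)
  | [s] => intro _ hmk; exact Or.inr ⟨s, hmk.symm⟩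
  | s :: t :: L =>
    intro hred hmk
    obtain ⟨hst, hL⟩ := isReduced_cons_cons_iff.1 hred
    rw [← hmk, lift_mk_cons, mul_smul] at hw
    exact absurd (P.smul_mem_of_ne hst (P.lift_smul_mem_closure hx L t hL)) (mem_level_zero.1 hw s)

omit [ContinuousConstSMul G X] in
/-- A word that moves a point of level `0` off the closures of all `B s` to a point of level `0`
is trivial. -/
theorem eq_one_of_smul_mem (P : IsPingPong gen B) {x : X} (hx : x ∈ level gen B 0)
    {w : FreeGroup α} (hw : ∀ s, FreeGroup.lift gen w • x ∉ closure (B s)) : w = 1 := by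
  rcases P.eq_one_or_letter hx
    (mem_level_zero.2 fun s h => hw s (subset_closure h)) with h | ⟨s, rfl⟩
  · exact h
  · exact absurd (P.lift_smul_mem_closure hx [] s FreeGroup.IsReduced.singleton) (hw s)

omit [ContinuousConstSMul G X] in
theorem eq_one_of_fixed (P : IsPingPong gen B) {x : X} (hx : x ∈ level gen B 0)
    {w : FreeGroup α} (hw : FreeGroup.lift gen w • x = x) : w = 1 := by
  rcases P.eq_one_or_letter hx (hw.symm ▸ hx) with h | ⟨s, rfl⟩
  · exact h
  · exfalso
    have h1 := P.lift_smul_mem_closure hx [] s FreeGroup.IsReduced.singleton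
    rw [hw] at h1
    rw [lift_mk_cons, ← FreeGroup.one_eq_mk, map_one, mul_one] at hw
    have h2 : letter gen (letterInv s) • x ∈ closure (B (letterInv s)) :=
      (P.smul_mem_closure _ _).2 (mem_level_zero.1 hx _)
    rw [letter_letterInv, inv_smul_eq_iff.2 hw.symm] at h2
    exact Set.disjoint_left.1 (P.disjoint _ _ (letterInv_ne s)) h2 h1

/-- Only finitely many translates of level `0` meet level `n`. -/
theorem finite_smul_mem_level [Finite α] (P : IsPingPong gen B) (n : ℕ) :
    {w : FreeGroup α | ∃ x ∈ level gen B 0, FreeGroup.lift gen w • x ∈ level gen B n}.Finite := by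
  have h0 : {w : FreeGroup α | ∃ x ∈ level gen B 0,
      FreeGroup.lift gen w • x ∈ level gen B 0}.Finite := by
    refine ((Set.finite_singleton (1 : FreeGroup α)).union
      (Set.finite_range fun s : α × Bool => FreeGroup.mk [s])).subset ?_
    rintro w ⟨x, hx, hw⟩
    rcases P.eq_one_or_letter hx hw with h | ⟨s, h⟩
    · exact Or.inl h
    · exact Or.inr ⟨s, h.symm⟩
  induction n with
  | zero => exact h0
  | succ n ih =>
    refine (h0.union (Set.finite_iUnion fun s : α × Bool =>
      ih.image fun w => FreeGroup.mk [s] * w)).subset ?_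
    rintro w ⟨x, hx, hw⟩
    rcases P.mem_level_succ hw with h | ⟨s, hs⟩
    · exact Or.inl ⟨x, hx, h⟩
    · refine Or.inr (Set.mem_iUnion.2 ⟨s, (FreeGroup.mk [s])⁻¹ * w, ⟨x, hx, ?_⟩,
        mul_inv_cancel_left _ _⟩)
      rw [map_mul, map_inv, lift_mk_cons, ← FreeGroup.one_eq_mk, map_one, mul_one, mul_smul]
      exact hs

omit [ContinuousConstSMul G X] in
/-- In a connected space some point lies off the closures of all `B s`. -/
theorem exists_notMem_closure [Finite α] [ConnectedSpace X] (P : IsPingPong gen B) :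
    ∃ x, ∀ s, x ∉ closure (B s) := by
  by_contra! h
  rcases isEmpty_or_nonempty (α × Bool) with hα | ⟨⟨s⟩⟩
  · obtain ⟨x⟩ : Nonempty X := inferInstance
    obtain ⟨s, -⟩ := h x
    exact hα.elim s
  have hco : (closure (B s))ᶜ = ⋃ t ∈ {t | t ≠ s}, closure (B t) := by
    ext x
    simp only [Set.mem_compl_iff, Set.mem_iUnion, exists_prop, Set.mem_ofPred_eq]
    constructor
    · intro hx
      obtain ⟨t, ht⟩ := h x
      exact ⟨t, fun e => hx (e ▸ ht), ht⟩
    · rintro ⟨t, hts, ht⟩ hx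
      exact Set.disjoint_left.1 (P.disjoint _ _ hts) ht hx
  have hopen : IsOpen (closure (B s)) := by
    rw [← isClosed_compl_iff, hco]
    exact (Set.toFinite _).isClosed_biUnion fun _ _ => isClosed_closure
  have huniv : closure (B s) = Set.univ :=
    IsClopen.eq_univ ⟨isClosed_closure, hopen⟩ (P.nonempty s).closure
  obtain ⟨x, hx⟩ := P.nonempty (letterInv s)
  exact Set.disjoint_left.1 (P.disjoint _ _ (letterInv_ne s)) (subset_closure hx)
    (huniv ▸ Set.mem_univ x)

/-- A boundary point of `B s` in level `0` is a limit of points off the closures of all the sets: it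
is the image under `s` of a boundary point of `B s⁻¹`, which is a limit of points of `B s⁻¹`. -/
theorem level_zero_subset_closure [Finite α] (P : IsPingPong gen B) :
    level gen B 0 ⊆ closure {x | ∀ s, x ∉ closure (B s)} := by
  intro x hx
  by_cases h : ∀ s, x ∉ closure (B s)
  · exact subset_closure h
  push Not at h
  obtain ⟨s, hs⟩ := h
  rw [mem_closure_iff]
  intro O hO hxO
  -- near `x` only the closure of `B s` is present; translate back by the letter `s`
  have hW : IsOpen (O ∩ (⋃ t ∈ {t | t ≠ s}, closure (B t))ᶜ) :=
    hO.inter (((Set.toFinite _).isClosed_biUnion fun _ _ => isClosed_closure).isOpen_compl)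
  have hy : (letter gen s)⁻¹ • x ∈ closure (B (letterInv s)) := by
    rw [← not_not (a := _ ∈ closure _), P.inv_smul_mem]
    exact mem_level_zero.1 hx s
  obtain ⟨y, hyW, hyB⟩ := mem_closure_iff.1 hy _
    (hW.preimage (continuous_const_smul (letter gen s)))
    ⟨by simpa using hxO, by
      simp only [smul_inv_smul, Set.mem_compl_iff, Set.mem_iUnion, not_exists]
      exact fun t ht hxt => Set.disjoint_left.1 (P.disjoint _ _ ht) hxt hs⟩
  refine ⟨letter gen s • y, hyW.1, fun t ht => ?_⟩
  by_cases hts : t = s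
  · subst hts
    exact (P.smul_mem_closure _ _).1 ht hyB
  · exact hyW.2 (Set.mem_biUnion (show t ∈ {t | t ≠ s} from hts) ht)

omit [ContinuousConstSMul G X] in
theorem lift_injective [Finite α] [ConnectedSpace X] (P : IsPingPong gen B) :
    Function.Injective (FreeGroup.lift gen) := by
  rw [injective_iff_map_eq_one]
  intro w hw
  obtain ⟨x, hx⟩ := P.exists_notMem_closure
  exact P.eq_one_of_smul_mem (mem_level_zero.2 fun s h => hx s (subset_closure h))
    (by rwa [hw, one_smul])

/-- A compact subset of the union of the levels lies in one level. -/
theorem exists_level_of_isCompact [Finite α] (P : IsPingPong gen B) {K : Set X} (hK : IsCompact K)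
    (h : ∀ x ∈ K, ∃ n, x ∈ level gen B n) : ∃ n, K ⊆ level gen B n := by
  obtain ⟨n, hn⟩ := hK.elim_directed_cover (fun n => interior (level gen B n))
    (fun _ => isOpen_interior)
    (fun x hx => by
      obtain ⟨n, hn⟩ := h x hx
      exact Set.mem_iUnion.2 ⟨n + 1, P.level_subset_interior n hn⟩)
    (Monotone.directed_le fun m n hmn => interior_mono (P.level_mono hmn))
  exact ⟨n, hn.trans interior_subset⟩

end IsPingPong

end PingPong

/-! ### Retractions -/

section Retraction

variable {X : Type*} [TopologicalSpace X]

/-- A retract of a simply connected set is simply connected. -/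
theorem IsSimplyConnected.of_retraction {s t : Set X} (hs : IsSimplyConnected s) (hts : t ⊆ s)
    {r : X → X} (hr : ContinuousOn r s) (hmap : Set.MapsTo r s t) (hid : ∀ x ∈ t, r x = x) :
    IsSimplyConnected t := by
  rw [isSimplyConnected_iff_exists_homotopy_refl_forall_mem] at hs ⊢
  refine ⟨?_, fun x p hp => ?_⟩
  · have : r '' s = t := by
      refine Set.Subset.antisymm hmap.image_subset fun x hx => ⟨x, hts hx, hid x hx⟩
    rw [← this]
    exact hs.1.image' hr
  · obtain ⟨F, hF⟩ := hs.2 x p fun t => hts (hp t)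
    have hx : x ∈ t := by simpa using hp 0
    refine ⟨{ toFun := fun a => r (F a)
              continuous_toFun := hr.comp_continuous F.continuous hF
              map_zero_left := fun a => ?_
              map_one_left := fun a => ?_
              prop' := fun a b hb => ?_ }, fun a => hmap (hF a)⟩
    · simpa using hid _ (hp a)
    · simpa using hid _ hx
    · have h1 : F (a, b) = p b := F.eq_fst a hb
      simp only [ContinuousMap.coe_mk, h1]
      exact hid _ (hp b)

/-- If the sets `D i` have disjoint closures and each `r i` pushes `D i \ K i` to the boundary of
`D i`, fixing the complement of `D i`, then the complement of the union of the `D i` is a retract of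
the complement of the union of the `K i`. -/
theorem exists_retraction {ι : Type*} [Finite ι] (D K : ι → Set X)
    (hdisj : Pairwise fun i j => Disjoint (closure (D i)) (closure (D j)))
    (r : ι → X → X) (hr : ∀ i, ContinuousOn (r i) (K i)ᶜ)
    (hid : ∀ i, ∀ x ∉ D i, r i x = x)
    (hmap : ∀ i, ∀ x ∈ D i, x ∉ K i → r i x ∈ closure (D i) \ D i) :
    ∃ ρ : X → X, ContinuousOn ρ (⋃ i, K i)ᶜ ∧ Set.MapsTo ρ (⋃ i, K i)ᶜ (⋃ i, D i)ᶜ ∧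
      ∀ x ∈ (⋃ i, D i)ᶜ, ρ x = x := by
  classical
  let ρ : X → X := fun x => if h : ∃ i, x ∈ D i then r h.choose x else x
  have hout : ∀ x, (∀ i, x ∉ D i) → ρ x = x := fun x hx => dif_neg (by simpa using hx)
  have hne : ∀ i j x, x ∈ closure (D i) → x ∈ closure (D j) → i = j := fun i j x hi hj => by
    by_contra hij
    exact Set.disjoint_left.1 (hdisj hij) hi hj
  have hin : ∀ i x, x ∈ D i → ρ x = r i x := fun i x hx => by
    have h : ∃ i, x ∈ D i := ⟨i, hx⟩
    have : h.choose = i := hne _ _ x (subset_closure h.choose_spec) (subset_closure hx)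
    simp only [ρ, dif_pos h, this]
  refine ⟨ρ, fun x hx => ?_, fun x hx => ?_, fun x hx => hout x (by simpa using hx)⟩
  · have hcl : ∀ p : ι → Prop, IsOpen (⋃ j ∈ {j | p j}, closure (D j))ᶜ := fun p =>
      ((Set.toFinite _).isClosed_biUnion fun _ _ => isClosed_closure).isOpen_compl
    by_cases hxD : ∃ i, x ∈ closure (D i)
    · obtain ⟨i, hi⟩ := hxD
      have hev : ρ =ᶠ[𝓝[(⋃ i, K i)ᶜ] x] r i := by
        refine Filter.Eventually.filter_mono nhdsWithin_le_nhds ?_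
        filter_upwards [(hcl (· ≠ i)).mem_nhds (by
          simp only [Set.mem_compl_iff, Set.mem_iUnion, not_exists]
          exact fun j hj hxj => hj (hne _ _ x hxj hi))] with y hy
        by_cases hyi : y ∈ D i
        · exact hin i y hyi
        · rw [hid i y hyi]
          refine hout y fun j hj => ?_
          by_cases hji : j = i
          · exact hyi (hji ▸ hj)
          · exact hy (Set.mem_biUnion (show j ∈ {j | j ≠ i} from hji) (subset_closure hj))
      have hsub : (⋃ i, K i)ᶜ ⊆ (K i)ᶜ := Set.compl_subset_compl.2 (Set.subset_iUnion K i)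
      exact ((hr i x (hsub hx)).mono hsub).congr_of_eventuallyEq hev (hev.self_of_nhdsWithin hx)
    · push Not at hxD
      have hev : ρ =ᶠ[𝓝[(⋃ i, K i)ᶜ] x] id := by
        refine Filter.Eventually.filter_mono nhdsWithin_le_nhds ?_
        filter_upwards [(hcl fun _ => True).mem_nhds (by simpa using hxD)] with y hy
        exact hout y fun j hj => hy (Set.mem_biUnion (show j ∈ {_j | True} from trivial)
          (subset_closure hj))
      exact continuousWithinAt_id.congr_of_eventuallyEq hev (hev.self_of_nhdsWithin hx)
  · simp only [Set.mem_compl_iff, Set.mem_iUnion, not_exists] at hx ⊢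
    by_cases hxD : ∃ i, x ∈ D i
    · obtain ⟨i, hi⟩ := hxD
      intro j hj
      rw [hin i x hi] at hj
      obtain ⟨h1, h2⟩ := hmap i x hi (hx i)
      obtain rfl := hne _ _ _ (subset_closure hj) h1
      exact h2 hj
    · push Not at hxD
      rw [hout x hxD]
      exact hxD

end Retraction

section LocallyFlatOperations

variable {E : Type*} [NormedAddCommGroup E] [NormedSpace ℝ E] {X : Type*} [TopologicalSpace X]

theorem IsLocallyFlat.image_homeomorph {k : ℕ} {A : Set X} (hA : IsLocallyFlat E k A)
    (h : X ≃ₜ X) : IsLocallyFlat E k (h '' A) := by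
  rintro _ ⟨x, hx, rfl⟩
  obtain ⟨e, hxe, L, hL, heL⟩ := hA x hx
  refine ⟨h.symm.transOpenPartialHomeomorph e, by simpa using hxe, L, hL, fun y hy => ?_⟩
  have hy' : h.symm y ∈ e.source := by simpa using hy
  have h1 : y ∈ h '' A ↔ h.symm y ∈ A := by
    rw [← h.preimage_symm]; rfl
  rw [h1, heL _ hy']
  simp

theorem IsLocallyFlat.iUnion {ι : Type*} [Finite ι] {k : ℕ} {A : ι → Set X}
    (hA : ∀ i, IsLocallyFlat E k (A i)) (hAc : ∀ i, IsClosed (A i))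
    (hdisj : Pairwise fun i j => Disjoint (A i) (A j)) : IsLocallyFlat E k (⋃ i, A i) := by
  intro x hx
  obtain ⟨i, hi⟩ := Set.mem_iUnion.1 hx
  obtain ⟨e, hxe, L, hL, heL⟩ := hA i x hi
  have hO : IsOpen (⋃ j ∈ {j | j ≠ i}, A j)ᶜ :=
    ((Set.toFinite _).isClosed_biUnion fun j _ => hAc j).isOpen_compl
  have hxO : x ∈ (⋃ j ∈ {j | j ≠ i}, A j)ᶜ := by
    simp only [Set.mem_compl_iff, Set.mem_iUnion, not_exists]
    exact fun j hj hxj => Set.disjoint_left.1 (hdisj hj) hxj hi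
  refine ⟨e.restrOpen _ hO, ⟨hxe, hxO⟩, L, hL, fun y hy => ?_⟩
  have hyi : y ∈ ⋃ i, A i ↔ y ∈ A i := by
    refine ⟨fun h => ?_, fun h => Set.mem_iUnion.2 ⟨i, h⟩⟩
    obtain ⟨j, hj⟩ := Set.mem_iUnion.1 h
    by_cases hji : j = i
    · exact hji ▸ hj
    · exact absurd (Set.mem_biUnion (show j ∈ {j | j ≠ i} from hji) hj) hy.2
  rw [hyi]
  exact heL y hy.1

theorem IsLocallyFlat.mono {k l : ℕ} (hkl : k ≤ l) {A : Set X} (hA : IsLocallyFlat E l A) :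
    IsLocallyFlat E k A := fun x hx => by
  obtain ⟨e, hxe, L, hL, heL⟩ := hA x hx
  exact ⟨e, hxe, L, hkl.trans hL, heL⟩

end LocallyFlatOperations

section ComplexSubmanifold

variable {E X : Type*} [NormedAddCommGroup E] [NormedSpace ℂ E]
  [TopologicalSpace X] [ChartedSpace E X]

theorem IsComplexSubmanifold.isLocallyFlat {k : ℕ} {C : Set X} (hC : IsComplexSubmanifold E k C) :
    IsLocallyFlat E (2 * k) C := by
  intro x hx
  obtain ⟨e, -, hxe, L, hL, heL⟩ := hC x hx
  refine ⟨e, hxe, L.restrictScalars ℝ, ?_, heL⟩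
  have h : Module.finrank ℝ (E ⧸ L.restrictScalars ℝ) = Module.finrank ℝ (E ⧸ L) := by
    exact LinearEquiv.finrank_eq (Submodule.Quotient.restrictScalarsEquiv ℝ L)
  rw [h, ← hL, finrank_real_of_complex]

/-- A proper nonempty closed complex submanifold of a connected manifold has positive
codimension. -/
theorem IsComplexSubmanifold.pos [FiniteDimensional ℂ E] [PreconnectedSpace X] {k : ℕ} {C : Set X}
    (hC : IsComplexSubmanifold E k C) (hCc : IsClosed C) (hne : C.Nonempty)
    (hC' : C ≠ Set.univ) : 1 ≤ k := by
  by_contra hk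
  obtain rfl : k = 0 := by omega
  refine hC' (IsClopen.eq_univ ⟨hCc, ?_⟩ hne)
  refine isOpen_iff_mem_nhds.2 fun x hx => ?_
  obtain ⟨e, -, hxe, L, hL, heL⟩ := hC x hx
  have : Subsingleton (E ⧸ L) := Module.finrank_zero_iff.1 hL
  have hL' : L = ⊤ := Submodule.Quotient.subsingleton_iff.1 this
  refine Filter.mem_of_superset (e.open_source.mem_nhds hxe) fun y hy => (heL y hy).2 ?_
  rw [hL']
  exact Submodule.mem_top

end ComplexSubmanifold

/-! ### The flow of a Schottky pair -/

section SchottkyFlow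

variable {E X : Type*} [NormedAddCommGroup E] [NormedSpace ℂ E]
  [TopologicalSpace X] [ChartedSpace E X]

instance HolAut.continuousConstSMul : ContinuousConstSMul (HolAut E X) X :=
  ⟨fun f => f.continuous⟩

/-- The action `t · s = t s / (1 + (t - 1) s)` of the positive reals on `[0, 1]`; the parameter is
the square of the one in the transformation law of an auxiliary function. -/
noncomputable def mobius (t s : ℝ) : ℝ := t * s / (1 + (t - 1) * s)

theorem mobius_denom_pos {t s : ℝ} (ht : 0 < t) (hs : s ∈ Set.Icc (0 : ℝ) 1) :
    0 < 1 + (t - 1) * s := by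
  rcases hs.2.eq_or_lt with h | h
  · rw [h]; linarith
  · have := mul_nonneg ht.le hs.1
    linarith

theorem mobius_lt {t s c : ℝ} (ht : 0 < t) (ht1 : t < 1) (hs : s ∈ Set.Icc (0 : ℝ) 1)
    (hc : s ≤ c) (hc0 : 0 < c) (hc1 : c < 1) : mobius t s < c := by
  rw [mobius, div_lt_iff₀ (mobius_denom_pos ht hs)]
  have h1 : 0 < (1 - t) * c * (1 - c) := by
    have := sub_pos.2 ht1; have := sub_pos.2 hc1; positivity
  have h2 : 0 ≤ (c - s) * (c + t * (1 - c)) := by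
    have := sub_nonneg.2 hc; have := sub_pos.2 hc1; positivity
  nlinarith

theorem one_sub_mobius {t s : ℝ} (ht : 0 < t) (hs : s ∈ Set.Icc (0 : ℝ) 1) :
    1 - mobius t s = mobius t⁻¹ (1 - s) := by
  have h1 := mobius_denom_pos ht hs
  have h2 : 0 < 1 + (t⁻¹ - 1) * (1 - s) :=
    mobius_denom_pos (inv_pos.2 ht) ⟨by linarith [hs.2], by linarith [hs.1]⟩
  have h3 : t * (1 + (t⁻¹ - 1) * (1 - s)) = 1 + (t - 1) * s := by field_simp; ring
  have h4 : 1 + (t⁻¹ - 1) * (1 - s) = (1 + (t - 1) * s) / t := by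
    rw [← h3]; field_simp
  rw [mobius, mobius, h4, one_sub_div h1.ne', div_div_eq_mul_div]
  congr 1
  field_simp
  ring

/-- The function `φ` for `b = false` and `1 - φ` for `b = true`. -/
def side (φ : X → ℝ) (b : Bool) (x : X) : ℝ := cond b (1 - φ x) (φ x)

/-- The nonzero complex number `exp τ`, for real `τ`. -/
noncomputable def expUnit (τ : ℝ) : ℂˣ := Units.mk0 (Complex.exp τ) (Complex.exp_ne_zero _)

theorem expUnit_zero : expUnit 0 = 1 := by ext; simp [expUnit]

theorem norm_expUnit_sq (τ : ℝ) : ‖(expUnit τ : ℂ)‖ ^ 2 = Real.exp (2 * τ) := by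
  rw [expUnit, Units.val_mk0, Complex.norm_exp, Complex.ofReal_re, ← Real.exp_nat_mul]
  norm_num

theorem continuous_expUnit : Continuous expUnit := by
  rw [Units.continuous_iff]
  refine ⟨?_, ?_⟩
  · exact Complex.continuous_exp.comp Complex.continuous_ofReal
  · have : (fun τ => ((expUnit τ)⁻¹ : ℂˣ).val) = fun τ : ℝ => Complex.exp (-τ) := by
      ext τ; simp [expUnit, Complex.exp_neg]
    rw [this]
    exact Complex.continuous_exp.comp Complex.continuous_ofReal.neg

namespace SchottkyPair

variable (S : SchottkyPair E X)

theorem continuous_action : Continuous fun p : ℂˣ × X => S.g p.1 p.2 := S.holomorphic.continuous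

/-- The real flow of a Schottky pair, reversed for `b = true`. It moves points away from the zero
set of `side φ b` in positive time. -/
noncomputable def flow (b : Bool) (τ : ℝ) (x : X) : X := S.g (expUnit (cond b (-τ) τ)) x

theorem flow_zero (b : Bool) (x : X) : S.flow b 0 x = x := by
  have : cond b (-(0 : ℝ)) 0 = 0 := by cases b <;> simp
  rw [flow, this, expUnit_zero, map_one]
  rfl

theorem continuous_flow (b : Bool) : Continuous fun p : ℝ × X => S.flow b p.1 p.2 := by
  refine S.continuous_action.comp ((continuous_expUnit.comp ?_).prodMk continuous_snd)
  cases b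
  · exact continuous_fst
  · exact continuous_fst.neg

variable {S} {φ : X → ℝ} (hφ : S.IsAuxiliary φ)
include hφ

namespace IsAuxiliary

theorem continuous_side (b : Bool) : Continuous (side φ b) := by
  cases b
  · exact hφ.continuous
  · exact continuous_const.sub hφ.continuous

theorem side_mem (b : Bool) (x : X) : side φ b x ∈ Set.Icc (0 : ℝ) 1 := by
  have := hφ.mem_Icc x
  cases b
  · exact this
  · exact ⟨by simp only [side, cond_true]; linarith [this.2], by
      simp only [side, cond_true]; linarith [this.1]⟩

theorem side_flow (b : Bool) (τ : ℝ) (x : X) :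
    side φ b (S.flow b τ x) = mobius (Real.exp (2 * τ)) (side φ b x) := by
  have h := hφ.equivariant (expUnit (cond b (-τ) τ)) x
  rw [norm_expUnit_sq] at h
  cases b
  · exact h
  · change 1 - φ (S.g (expUnit (-τ)) x) = _
    have h' : φ (S.g (expUnit (-τ)) x) = mobius (Real.exp (2 * -τ)) (φ x) := h
    rw [h', one_sub_mobius (Real.exp_pos _) (hφ.mem_Icc x), ← Real.exp_neg]
    simp [side]

theorem closure_side_lt (b : Bool) {c : ℝ} (hc0 : 0 < c) (hc1 : c < 1) :
    closure {x | side φ b x < c} = {x | side φ b x ≤ c} := by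
  refine Set.Subset.antisymm (closure_minimal (fun x hx => (show side φ b x < c from hx).le)
    (isClosed_le (hφ.continuous_side b) continuous_const)) fun x hx => ?_
  have hlim : Filter.Tendsto (fun τ : ℝ => S.flow b τ x) (𝓝[<] 0) (𝓝 x) := by
    have h1 : Continuous fun τ : ℝ => S.flow b τ x :=
      (S.continuous_flow b).comp (continuous_id.prodMk continuous_const)
    have h2 := h1.tendsto 0
    rw [S.flow_zero] at h2
    exact h2.mono_left nhdsWithin_le_nhds
  refine mem_closure_of_tendsto hlim ?_
  filter_upwards [self_mem_nhdsWithin] with τ hτ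
  have hτ' : τ < 0 := hτ
  change side φ b (S.flow b τ x) < c
  rw [hφ.side_flow]
  exact mobius_lt (Real.exp_pos _) (Real.exp_lt_one_iff.2 (by linarith))
    (hφ.side_mem b x) hx hc0 hc1

/-- The points of the zero set of `side φ b` can be pushed out of its tubular neighbourhood
`side φ b < c`, to its boundary. -/
theorem exists_push (b : Bool) {c : ℝ} (hc0 : 0 < c) (hc1 : c < 1) :
    ∃ r : X → X, ContinuousOn r {x | side φ b x = 0}ᶜ ∧ (∀ x, c ≤ side φ b x → r x = x) ∧
      ∀ x, side φ b x < c → side φ b x ≠ 0 → side φ b (r x) = c := by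
  -- the flow at parameter `t` moves the level `s < c` to the level `c`
  let t : X → ℝ := fun x => max 1 (c * (1 - side φ b x) / (side φ b x * (1 - c)))
  have ht : ∀ x, 1 ≤ t x := fun x => le_max_left _ _
  have htpos : ∀ x, 0 < t x := fun x => lt_of_lt_of_le one_pos (ht x)
  have hexp : ∀ x, Real.exp (2 * (Real.log (t x) / 2)) = t x := fun x => by
    rw [mul_div_cancel₀ _ two_ne_zero, Real.exp_log (htpos x)]
  have hc1' : 0 < 1 - c := by linarith
  refine ⟨fun x => S.flow b (Real.log (t x) / 2) x, ?_, ?_, ?_⟩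
  · have hs := (hφ.continuous_side b).continuousOn (s := {x | side φ b x = 0}ᶜ)
    have htc : ContinuousOn t {x | side φ b x = 0}ᶜ := by
      refine (continuous_const.max continuous_id).comp_continuousOn (ContinuousOn.div
        (continuousOn_const.mul (continuousOn_const.sub hs)) (hs.mul continuousOn_const)
        fun x hx => ?_)
      exact mul_ne_zero hx hc1'.ne'
    exact (S.continuous_flow b).comp_continuousOn
      (((htc.log fun x _ => (htpos x).ne').div_const 2).prodMk continuousOn_id)
  · intro x hx
    have hsx : 0 < side φ b x := hc0.trans_le hx
    have : t x = 1 := by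
      refine max_eq_left ?_
      rw [div_le_one (by positivity)]
      nlinarith
    simp only [this, Real.log_one, zero_div, S.flow_zero]
  · intro x hx hx0
    have hmem := hφ.side_mem b x
    have hs0 : 0 < side φ b x := lt_of_le_of_ne hmem.1 (Ne.symm hx0)
    have hs1 : 0 < 1 - side φ b x := by linarith
    have : t x = c * (1 - side φ b x) / (side φ b x * (1 - c)) := by
      refine max_eq_right ?_
      rw [le_div_iff₀ (by positivity)]
      nlinarith
    rw [hφ.side_flow, hexp, mobius, div_eq_iff (mobius_denom_pos (htpos x) hmem).ne', this]
    field_simp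
    ring

end IsAuxiliary

end SchottkyPair

end SchottkyFlow

/-! ### The discs of a Schottky group -/

namespace SchottkyData

variable {E X : Type*} [NormedAddCommGroup E] [NormedSpace ℂ E]
  [TopologicalSpace X] [ChartedSpace E X] {S : SchottkyPair E X} {r : ℕ} (D : SchottkyData S r)

/-- `V_j` for the letter `j` and `U_j` for the letter `j⁻¹`. -/
def ball (s : Fin r × Bool) : Set X := D.f s.1 '' {x | side D.φ s.2 x < D.ε s.1}

theorem ball_true (j : Fin r) : D.ball (j, true) = D.V j := by
  simp only [ball, V, side, cond_true]
  congr 1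
  ext x
  exact ⟨fun h => by simp only [Set.mem_ofPred_eq] at *; linarith,
    fun h => by simp only [Set.mem_ofPred_eq] at *; linarith⟩

theorem ball_false (j : Fin r) : D.ball (j, false) = D.U j := rfl

theorem mem_ball (s : Fin r × Bool) (x : X) :
    x ∈ D.ball s ↔ side D.φ s.2 ((D.f s.1)⁻¹ • x) < D.ε s.1 := by
  constructor
  · rintro ⟨y, hy, rfl⟩
    rw [← HolAut.smul_def, inv_smul_smul]
    exact hy
  · exact fun h => ⟨_, h, smul_inv_smul (D.f s.1) x⟩

theorem ε_lt_one (j : Fin r) : D.ε j < 1 := (D.ε_lt j).trans (by norm_num)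

theorem mem_closure_ball (s : Fin r × Bool) (x : X) :
    x ∈ closure (D.ball s) ↔ side D.φ s.2 ((D.f s.1)⁻¹ • x) ≤ D.ε s.1 := by
  have h1 : D.ball s = (fun x => (D.f s.1)⁻¹ • x) ⁻¹' {x | side D.φ s.2 x < D.ε s.1} := by
    ext x; exact D.mem_ball s x
  have h2 := (Homeomorph.smul (D.f s.1)⁻¹).preimage_closure {x | side D.φ s.2 x < D.ε s.1}
  rw [D.auxiliary.closure_side_lt _ (D.ε_pos _) (D.ε_lt_one _)] at h2
  rw [h1]
  exact (Set.ext_iff.1 h2 x).symm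

/-- By the choice of `|λ_j|`, the map `g_{λ_j}` takes `{φ = ε_j}` to `{φ = 1 - ε_j}`. -/
theorem le_mobius_iff (j : Fin r) (x : X) :
    1 - D.ε j ≤ D.φ (S.g (D.lam j) x) ↔ D.ε j ≤ D.φ x := by
  have h0 := D.ε_pos j
  have h1 := D.ε_lt_one j
  have hn : 0 < ‖(D.lam j : ℂ)‖ ^ 2 := by
    rw [D.norm_lam]; have := sub_pos.2 h1; positivity
  have hden := mobius_denom_pos hn (D.auxiliary.mem_Icc x)
  rw [D.auxiliary.equivariant, le_div_iff₀ hden, D.norm_lam, div_pow, ← sub_nonneg,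
    ← sub_nonneg (b := D.ε j)]
  have key : (1 - D.ε j) ^ 2 / D.ε j ^ 2 * D.φ x -
      (1 - D.ε j) * (1 + ((1 - D.ε j) ^ 2 / D.ε j ^ 2 - 1) * D.φ x) =
      ((1 - D.ε j) / D.ε j) * (D.φ x - D.ε j) := by
    field_simp
    ring
  rw [key, mul_nonneg_iff_of_pos_left (div_pos (by linarith) h0)]

theorem mobius_le_iff (j : Fin r) (x : X) :
    D.φ (S.g (D.lam j) x) ≤ 1 - D.ε j ↔ D.φ x ≤ D.ε j := by
  have h0 := D.ε_pos j
  have h1 := D.ε_lt_one j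
  have hn : 0 < ‖(D.lam j : ℂ)‖ ^ 2 := by
    rw [D.norm_lam]; have := sub_pos.2 h1; positivity
  have hden := mobius_denom_pos hn (D.auxiliary.mem_Icc x)
  rw [D.auxiliary.equivariant, div_le_iff₀ hden, D.norm_lam, div_pow, ← sub_nonneg,
    ← sub_nonneg (a := D.ε j)]
  have key : (1 - D.ε j) * (1 + ((1 - D.ε j) ^ 2 / D.ε j ^ 2 - 1) * D.φ x) -
      (1 - D.ε j) ^ 2 / D.ε j ^ 2 * D.φ x =
      ((1 - D.ε j) / D.ε j) * (D.ε j - D.φ x) := by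
    field_simp
    ring
  rw [key, mul_nonneg_iff_of_pos_left (div_pos (by linarith) h0)]

theorem disjoint_closure_ball (s t : Fin r × Bool) (hst : s ≠ t) :
    Disjoint (closure (D.ball s)) (closure (D.ball t)) := by
  let e : Fin r × Bool → Fin r ⊕ Fin r := fun s => cond s.2 (Sum.inr s.1) (Sum.inl s.1)
  have he : Function.Injective e := by
    rintro ⟨a, _ | _⟩ ⟨b, _ | _⟩ h <;> simp_all [e]
  have hB : ∀ s, D.ball s = Sum.elim (fun j => D.f j '' {x | D.φ x < D.ε j})
        (fun j => D.f j '' {x | 1 - D.ε j < D.φ x}) (e s) := by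
    rintro ⟨a, _ | _⟩
    · rfl
    · exact D.ball_true a
  rw [hB s, hB t]
  exact D.disjoint_closure fun h => hst (he h)

theorem isPingPong : IsPingPong D.gen D.ball where
  isOpen s := by
    have : D.ball s = (fun x => (D.f s.1)⁻¹ • x) ⁻¹' {x | side D.φ s.2 x < D.ε s.1} := by
      ext x; exact D.mem_ball s x
    rw [this]
    exact (isOpen_lt (D.auxiliary.continuous_side _) continuous_const).preimage
      (continuous_const_smul _)
  nonempty s := by
    refine Set.Nonempty.image _ ?_
    rcases s with ⟨j, _ | _⟩
    · obtain ⟨x, hx⟩ := S.connected₀.nonempty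
      rw [← D.auxiliary.zero_set] at hx
      exact ⟨x, by have : D.φ x = 0 := hx; simp [side, this, D.ε_pos]⟩
    · obtain ⟨x, hx⟩ := S.connected₁.nonempty
      rw [← D.auxiliary.one_set] at hx
      exact ⟨x, by have : D.φ x = 1 := hx; simp [side, this, D.ε_pos]⟩
  disjoint := D.disjoint_closure_ball
  smul_mem_closure s x := by
    rw [D.mem_closure_ball, D.mem_ball, not_lt]
    rcases s with ⟨j, _ | _⟩
    · have h : (D.f j)⁻¹ • letter D.gen (j, false) • x = (S.g (D.lam j))⁻¹ • (D.f j)⁻¹ • x := by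
        simp only [letter, cond_false, gen, mul_inv_rev, inv_inv, mul_smul, inv_smul_smul]
      simp only [h, side, letterInv, cond_false, Bool.not_false, cond_true]
      have h2 := D.mobius_le_iff j ((S.g (D.lam j))⁻¹ • (D.f j)⁻¹ • x)
      rw [← HolAut.smul_def, smul_inv_smul] at h2
      rw [← h2]
      exact le_sub_comm
    · have h : (D.f j)⁻¹ • letter D.gen (j, true) • x = S.g (D.lam j) • (D.f j)⁻¹ • x := by
        simp only [letter, cond_true, gen, mul_smul, inv_smul_smul]
      simp only [h, side, letterInv, cond_false, Bool.not_true, cond_true]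
      have h2 := D.le_mobius_iff j ((D.f j)⁻¹ • x)
      rw [← h2, HolAut.smul_def]
      exact sub_le_comm

theorem fundamentalSet_eq : D.fundamentalSet = level D.gen D.ball 0 := by
  ext x
  rw [mem_level_zero]
  simp only [fundamentalSet, Set.mem_compl_iff, Set.mem_iUnion, Set.mem_union, not_exists, not_or]
  refine ⟨?_, fun h j => ⟨D.ball_false j ▸ h (j, false), D.ball_true j ▸ h (j, true)⟩⟩
  rintro h ⟨j, _ | _⟩
  · exact (h j).1
  · rw [D.ball_true]; exact (h j).2

end SchottkyData

/-! ### Connectedness of the levels -/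

namespace SchottkyData

variable {E X : Type*} [NormedAddCommGroup E] [NormedSpace ℂ E]
  [TopologicalSpace X] [ChartedSpace E X] {S : SchottkyPair E X} {r : ℕ} (D : SchottkyData S r)

/-- The submanifold `C₀` or `C₁` in which `side D.φ b` vanishes. -/
def core (S : SchottkyPair E X) (b : Bool) : Set X := cond b S.C₁ S.C₀

theorem side_eq_zero (b : Bool) (x : X) : side D.φ b x = 0 ↔ x ∈ core S b := by
  cases b
  · rw [core, cond_false, ← D.auxiliary.zero_set]; rfl
  · rw [core, cond_true, ← D.auxiliary.one_set]
    simp only [side, cond_true, Set.mem_preimage, Set.mem_singleton_iff]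
    exact ⟨fun h => by linarith, fun h => by linarith⟩

theorem isClosed_core [T2Space X] (S : SchottkyPair E X) (b : Bool) : IsClosed (core S b) := by
  cases b
  · exact S.compact₀.isClosed
  · exact S.compact₁.isClosed

theorem isLocallyFlat_core [FiniteDimensional ℂ E] [T2Space X] [ConnectedSpace X]
    (S : SchottkyPair E X) (b : Bool) : IsLocallyFlat E 2 (core S b) := by
  obtain ⟨x₀, hx₀⟩ := S.connected₀.nonempty
  obtain ⟨x₁, hx₁⟩ := S.connected₁.nonempty
  cases b
  · obtain ⟨k, hk⟩ := S.submanifold₀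
    have := hk.pos S.compact₀.isClosed ⟨x₀, hx₀⟩
      (fun h => Set.disjoint_left.1 S.disjoint (h ▸ Set.mem_univ x₁) hx₁)
    exact hk.isLocallyFlat.mono (by omega)
  · obtain ⟨k, hk⟩ := S.submanifold₁
    have := hk.pos S.compact₁.isClosed ⟨x₁, hx₁⟩
      (fun h => Set.disjoint_left.1 S.disjoint hx₀ (h ▸ Set.mem_univ x₀))
    exact hk.isLocallyFlat.mono (by omega)

/-- The reduced words of length `n + 1`. -/
abbrev Words (r n : ℕ) : Type :=
  {L : List (Fin r × Bool) // FreeGroup.IsReduced L ∧ L.length = n + 1}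

instance (n : ℕ) : Finite (Words r n) := (IsPingPong.finite_words (α := Fin r) (n + 1)).to_subtype

theorem nest_append_singleton : ∀ (L : List (Fin r × Bool)) (s : Fin r × Bool) (x : X),
    x ∈ nest D.gen D.ball (L ++ [s]) ↔
      (FreeGroup.lift D.gen (FreeGroup.mk L))⁻¹ • x ∈ D.ball s
  | [], s, x => by simp [nest, ← FreeGroup.one_eq_mk]
  | [t], s, x => by
    rw [lift_mk_cons, ← FreeGroup.one_eq_mk, map_one, mul_one]
    rfl
  | t :: u :: L, s, x => by
    rw [lift_mk_cons, mul_inv_rev, mul_smul]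
    exact nest_append_singleton (u :: L) s ((letter D.gen t)⁻¹ • x)

/-- The disc of a reduced word is a translate of a tubular neighbourhood of `C₀` or `C₁`. -/
theorem exists_nest_eq {n : ℕ} (L : Words r n) : ∃ (h : HolAut E X) (s : Fin r × Bool), ∀ x,
    x ∈ nest D.gen D.ball L.1 ↔ side D.φ s.2 (h⁻¹ • x) < D.ε s.1 := by
  obtain ⟨L, hL, hlen⟩ := L
  rcases List.eq_nil_or_concat' L with rfl | ⟨L', s, rfl⟩
  · simp at hlen
  · refine ⟨FreeGroup.lift D.gen (FreeGroup.mk L') * D.f s.1, s, fun x => ?_⟩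
    rw [nest_append_singleton, mem_ball, mul_inv_rev, mul_smul]

/-- Level `n` is a retract of the complement of a finite union of disjoint translates of `C₀` and
`C₁`. -/
theorem exists_level_retraction (n : ℕ) :
    ∃ (h : Words r n → HolAut E X) (b : Words r n → Bool),
      (Pairwise fun i j => Disjoint (h i '' core S (b i)) (h j '' core S (b j))) ∧
      level D.gen D.ball n ⊆ (⋃ i, h i '' core S (b i))ᶜ ∧
      ∃ ρ : X → X, ContinuousOn ρ (⋃ i, h i '' core S (b i))ᶜ ∧
        Set.MapsTo ρ (⋃ i, h i '' core S (b i))ᶜ (level D.gen D.ball n) ∧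
        ∀ x ∈ level D.gen D.ball n, ρ x = x := by
  choose h s hs using fun L : Words r n => D.exists_nest_eq L
  choose p hp₁ hp₂ hp₃ using fun b j => D.auxiliary.exists_push b (D.ε_pos j) (D.ε_lt_one j)
  have hlev : level D.gen D.ball n = (⋃ L : Words r n, nest D.gen D.ball L.1)ᶜ := by
    ext x
    simp [level]
  have hmem : ∀ (g : HolAut E X) (A : Set X) (x : X), x ∈ g '' A ↔ g⁻¹ • x ∈ A := fun g A x => by
    constructor
    · rintro ⟨y, hy, rfl⟩
      rwa [← HolAut.smul_def, inv_smul_smul]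
    · exact fun hx => ⟨_, hx, smul_inv_smul g x⟩
  have hcore : ∀ (L : Words r n) (x : X), x ∈ h L '' core S (s L).2 ↔
      side D.φ (s L).2 ((h L)⁻¹ • x) = 0 := fun L x => by
    rw [hmem, side_eq_zero]
  have hsub : ∀ L : Words r n, h L '' core S (s L).2 ⊆ nest D.gen D.ball L.1 := fun L x hx => by
    rw [hs, (hcore L x).1 hx]
    exact D.ε_pos _
  have hdisj : Pairwise fun L L' : Words r n =>
      Disjoint (closure (nest D.gen D.ball L.1)) (closure (nest D.gen D.ball L'.1)) :=
    fun L L' hne => D.isPingPong.disjoint_closure_nest _ _ L.2.1 L'.2.1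
      (L.2.2.trans L'.2.2.symm) fun e => hne (Subtype.ext e)
  have hcl : ∀ (L : Words r n) (x : X), side D.φ (s L).2 ((h L)⁻¹ • x) ≤ D.ε (s L).1 →
      x ∈ closure (nest D.gen D.ball L.1) := fun L x hx => by
    have h1 : nest D.gen D.ball L.1 =
        (fun x => (h L)⁻¹ • x) ⁻¹' {x | side D.φ (s L).2 x < D.ε (s L).1} := by
      ext x; exact hs L x
    have h2 := (Homeomorph.smul (h L)⁻¹).preimage_closure
      {x | side D.φ (s L).2 x < D.ε (s L).1}
    rw [D.auxiliary.closure_side_lt _ (D.ε_pos _) (D.ε_lt_one _)] at h2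
    rw [h1]
    exact (Set.ext_iff.1 h2 x).1 hx
  refine ⟨h, fun L => (s L).2, fun L L' hne => (hdisj hne).mono
    ((hsub L).trans subset_closure) ((hsub L').trans subset_closure), ?_, ?_⟩
  · rw [hlev]
    exact Set.compl_subset_compl.2 (Set.iUnion_mono hsub)
  · rw [hlev]
    refine exists_retraction _ _ hdisj
      (fun L x => h L • p (s L).2 (s L).1 ((h L)⁻¹ • x)) (fun L => ?_) (fun L x hx => ?_)
      (fun L x hx hx0 => ?_)
    · refine (continuous_const_smul (h L)).comp_continuousOn
        ((hp₁ (s L).2 (s L).1).comp (continuous_const_smul _).continuousOn fun x hx hx0 => ?_)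
      exact hx ((hcore L x).2 hx0)
    · rw [hp₂ _ _ _ (not_lt.1 fun h' => hx ((hs L x).2 h')), smul_inv_smul]
    · have h1 : side D.φ (s L).2 (p (s L).2 (s L).1 ((h L)⁻¹ • x)) = D.ε (s L).1 :=
        hp₃ _ _ _ ((hs L x).1 hx) fun h0 => hx0 ((hcore L x).2 h0)
      refine ⟨hcl L _ ?_, fun h' => ?_⟩
      · rw [inv_smul_smul]; exact h1.le
      · rw [hs, inv_smul_smul] at h'
        exact h'.ne h1

variable [T2Space X]

theorem isLocallyFlat_translates {n k : ℕ} {h : Words r n → HolAut E X} {b : Words r n → Bool}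
    (hdisj : Pairwise fun i j => Disjoint (h i '' core S (b i)) (h j '' core S (b j)))
    (hflat : ∀ b, IsLocallyFlat E k (core S b)) :
    IsLocallyFlat E k (⋃ i, h i '' core S (b i)) ∧ IsClosed (⋃ i, h i '' core S (b i)) := by
  have hc : ∀ i, IsClosed (h i '' core S (b i)) := fun i =>
    (h i).toHomeomorph.isClosedMap _ (isClosed_core S _)
  exact ⟨IsLocallyFlat.iUnion (fun i => (hflat (b i)).image_homeomorph (h i).toHomeomorph) hc hdisj,
    isClosed_iUnion_of_finite hc⟩

theorem isPathConnected_level [FiniteDimensional ℂ E] [ConnectedSpace X] (n : ℕ) :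
    IsPathConnected (level D.gen D.ball n) := by
  obtain ⟨h, b, hdisj, hsub, ρ, hρ, hmap, hid⟩ := D.exists_level_retraction n
  obtain ⟨hflat, hcl⟩ := isLocallyFlat_translates hdisj (isLocallyFlat_core S)
  have : ρ '' (⋃ i, h i '' core S (b i))ᶜ = level D.gen D.ball n :=
    Set.Subset.antisymm hmap.image_subset fun x hx => ⟨x, hsub hx, hid x hx⟩
  rw [← this]
  exact (hflat.isPathConnected_compl hcl).image' hρ

theorem isSimplyConnected_level [FiniteDimensional ℂ E] [SimplyConnectedSpace X]
    (hflat : ∀ b, IsLocallyFlat E 3 (core S b)) (n : ℕ) :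
    IsSimplyConnected (level D.gen D.ball n) := by
  obtain ⟨h, b, hdisj, hsub, ρ, hρ, hmap, hid⟩ := D.exists_level_retraction n
  obtain ⟨hflat, hcl⟩ := isLocallyFlat_translates hdisj hflat
  exact (hflat.isSimplyConnected_compl hcl).of_retraction hsub hρ hmap hid

end SchottkyData

/-! ### The action on the domain -/

namespace SchottkyData

variable {E X : Type*} [NormedAddCommGroup E] [NormedSpace ℂ E]
  [TopologicalSpace X] [ChartedSpace E X] {S : SchottkyPair E X} {r : ℕ} (D : SchottkyData S r)

theorem mem_group_iff (γ : HolAut E X) :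
    γ ∈ D.group ↔ ∃ w : FreeGroup (Fin r), FreeGroup.lift D.gen w = γ := by
  rw [group, ← FreeGroup.range_lift_eq_closure]
  rfl

theorem mem_domain_iff (x : X) : x ∈ D.domain ↔ ∃ n, x ∈ level D.gen D.ball n := by
  rw [D.isPingPong.iUnion_level]
  change x ∈ ⋃ γ : D.group, (fun x => γ • x) '' D.fundamentalSet ↔ _
  rw [D.fundamentalSet_eq]
  simp only [Set.mem_iUnion]
  constructor
  · rintro ⟨⟨γ, hγ⟩, y, hy, rfl⟩
    obtain ⟨w, rfl⟩ := (D.mem_group_iff γ).1 hγ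
    exact ⟨w, by simpa [Subgroup.smul_def] using hy⟩
  · rintro ⟨w, hw⟩
    exact ⟨⟨_, (D.mem_group_iff _).2 ⟨w, rfl⟩⟩, _, hw, smul_inv_smul _ _⟩

theorem level_subset_domain (n : ℕ) : level D.gen D.ball n ⊆ D.domain := fun x hx =>
  (D.mem_domain_iff x).2 ⟨n, hx⟩

theorem isOpen_domain : IsOpen (D.domain : Set X) := by
  refine isOpen_iff_mem_nhds.2 fun x hx => ?_
  obtain ⟨n, hn⟩ := (D.mem_domain_iff x).1 hx
  exact Filter.mem_of_superset
    (mem_interior_iff_mem_nhds.1 (D.isPingPong.level_subset_interior n hn))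
    (D.level_subset_domain (n + 1))

theorem exists_level_of_isCompact {K : Set D.domain} (hK : IsCompact K) :
    ∃ n, ∀ x ∈ K, (x : X) ∈ level D.gen D.ball n := by
  obtain ⟨n, hn⟩ := D.isPingPong.exists_level_of_isCompact (hK.image continuous_subtype_val)
    (by rintro _ ⟨x, -, rfl⟩; exact (D.mem_domain_iff x).1 x.2)
  exact ⟨n, fun x hx => hn ⟨x, hx, rfl⟩⟩

/-- The Schottky group is free on its generators. -/
theorem exists_freeGroup_mulEquiv [ConnectedSpace X] : ∃ e : FreeGroup (Fin r) ≃* D.group,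
    ∀ j, (e (FreeGroup.of j) : HolAut E X) = D.gen j := by
  refine ⟨(MonoidHom.ofInjective D.isPingPong.lift_injective).trans
    (MulEquiv.subgroupCongr FreeGroup.range_lift_eq_closure), fun j => ?_⟩
  change FreeGroup.lift D.gen (FreeGroup.of j) = _
  simp

theorem exists_mem_fundamentalSet (x : D.domain) :
    ∃ γ : D.group, ∃ y : D.domain, (y : X) ∈ level D.gen D.ball 0 ∧ γ • y = x := by
  obtain ⟨w, hw⟩ := (D.isPingPong.iUnion_level x).1 ((D.mem_domain_iff x).1 x.2)
  exact ⟨⟨_, (D.mem_group_iff _).2 ⟨w, rfl⟩⟩, ⟨_, D.level_subset_domain 0 hw⟩, hw,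
    Subtype.ext (smul_inv_smul _ _)⟩

theorem eq_one_of_smul_eq (γ : D.group) (x : D.domain) (h : γ • x = x) : γ = 1 := by
  obtain ⟨δ, y, hy, rfl⟩ := D.exists_mem_fundamentalSet x
  have h1 : (δ⁻¹ * γ * δ) • y = y := by
    rw [mul_smul, mul_smul, h, inv_smul_smul]
  obtain ⟨w, hw⟩ := (D.mem_group_iff _).1 (δ⁻¹ * γ * δ).2
  have hw1 : w = 1 := D.isPingPong.eq_one_of_fixed hy
    (by rw [hw]; exact congrArg Subtype.val h1)
  rw [hw1, map_one] at hw
  have h2 : δ⁻¹ * γ * δ = 1 := Subtype.ext hw.symm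
  rwa [mul_assoc, inv_mul_eq_one, right_eq_mul] at h2

theorem finite_smul_mem_level (n : ℕ) :
    {γ : D.group | ∃ x : D.domain, (x : X) ∈ level D.gen D.ball 0 ∧
      ((γ • x : D.domain) : X) ∈ level D.gen D.ball n}.Finite := by
  have h := (D.isPingPong.finite_smul_mem_level n).image (FreeGroup.lift D.gen)
  refine (h.preimage (f := ((↑) : D.group → HolAut E X))
    Subtype.val_injective.injOn).subset ?_
  rintro γ ⟨x, hx, hγ⟩
  obtain ⟨w, hw⟩ := (D.mem_group_iff _).1 γ.2
  exact ⟨w, ⟨x, hx, by rw [hw]; exact hγ⟩, hw⟩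

instance : ContinuousConstSMul D.group D.domain :=
  ⟨fun γ => ((continuous_const_smul (γ : HolAut E X)).comp continuous_subtype_val).subtype_mk _⟩

instance : ProperlyDiscontinuousSMul D.group D.domain where
  finite_disjoint_inter_image := by
    intro K L hK hL
    obtain ⟨m, hm⟩ := D.exists_level_of_isCompact hK
    obtain ⟨n, hn⟩ := D.exists_level_of_isCompact hL
    -- cover `K` by the finitely many translates of the fundamental set that meet level `m`
    refine ((D.finite_smul_mem_level n).image2 (fun α β => α * β⁻¹)
      (D.finite_smul_mem_level m)).subset ?_
    intro γ hγ
    obtain ⟨_, ⟨x, hx, rfl⟩, hxL⟩ := hγ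
    obtain ⟨δ, y, hy, rfl⟩ := D.exists_mem_fundamentalSet x
    exact ⟨γ * δ, ⟨y, hy, by rw [mul_smul]; exact hn _ hxL⟩, δ, ⟨y, hy, hm _ hx⟩,
      mul_inv_cancel_right γ δ⟩

theorem notMem_closure_of_mem_interior {x : X} (hx : x ∈ interior (level D.gen D.ball 0))
    (s : Fin r × Bool) : x ∉ closure (D.ball s) := by
  intro h
  obtain ⟨y, hy, hys⟩ := mem_closure_iff.1 h _ isOpen_interior hx
  exact mem_level_zero.1 (interior_subset hy) s hys

theorem isTopFundamentalDomain :
    IsTopFundamentalDomain D.group {x : D.domain | (x : X) ∈ D.fundamentalSet} := by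
  have hemb := D.isOpen_domain.isOpenEmbedding_subtypeVal
  have hF : {x : D.domain | (x : X) ∈ D.fundamentalSet} =
      ((↑) : D.domain → X) ⁻¹' level D.gen D.ball 0 := by
    rw [← D.fundamentalSet_eq]; rfl
  have hint : interior (((↑) : D.domain → X) ⁻¹' level D.gen D.ball 0) =
      ((↑) : D.domain → X) ⁻¹' interior (level D.gen D.ball 0) :=
    (hemb.isOpenMap.preimage_interior_eq_interior_preimage continuous_subtype_val _).symm
  have hcl : ((↑) : D.domain → X) ⁻¹' closure (interior (level D.gen D.ball 0)) =
      closure (((↑) : D.domain → X) ⁻¹' interior (level D.gen D.ball 0)) :=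
    hemb.isOpenMap.preimage_closure_eq_closure_preimage continuous_subtype_val _
  rw [hF]
  have hclosed : IsClosed (((↑) : D.domain → X) ⁻¹' level D.gen D.ball 0) :=
    (D.isPingPong.isClosed_level 0).preimage continuous_subtype_val
  refine ⟨hclosed, ?_, fun x => ?_, fun γ δ hne => ?_, fun x => ?_⟩
  · refine Set.Subset.antisymm (closure_minimal interior_subset hclosed) ?_
    rw [hint, ← hcl]
    refine Set.preimage_mono ((D.isPingPong.level_zero_subset_closure).trans (closure_mono ?_))
    refine interior_maximal (fun x hx => mem_level_zero.2 fun s h => hx s (subset_closure h)) ?_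
    simp only [Set.ofPred_forall]
    exact isOpen_iInter_of_finite fun s => isClosed_closure.isOpen_compl
  · obtain ⟨γ, y, hy, h⟩ := D.exists_mem_fundamentalSet x
    exact ⟨γ, y, hy, h⟩
  · rw [hint, Set.disjoint_left]
    rintro _ ⟨x, hx, rfl⟩ ⟨y, hy, hxy⟩
    have hxy' : (δ⁻¹ * γ) • x = y := by
      rw [mul_smul, inv_smul_eq_iff]; exact hxy.symm
    obtain ⟨w, hw⟩ := (D.mem_group_iff _).1 (δ⁻¹ * γ).2
    have hw1 : w = 1 := D.isPingPong.eq_one_of_smul_mem (interior_subset hx) fun s => by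
      have : FreeGroup.lift D.gen w • (x : X) = y := by
        rw [hw]; exact congrArg Subtype.val hxy'
      rw [this]
      exact D.notMem_closure_of_mem_interior hy s
    rw [hw1, map_one] at hw
    have h2 : δ⁻¹ * γ = 1 := Subtype.ext hw.symm
    exact hne (inv_mul_eq_one.1 h2).symm
  · obtain ⟨n, hn⟩ := (D.mem_domain_iff x).1 x.2
    refine ⟨_, continuous_subtype_val.continuousAt.preimage_mem_nhds
      (mem_interior_iff_mem_nhds.1 (D.isPingPong.level_subset_interior n hn)),
      (D.finite_smul_mem_level (n + 1)).subset ?_⟩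
    rintro γ ⟨_, ⟨y, hy, rfl⟩, hy'⟩
    exact ⟨y, hy, hy'⟩

/-! ### The quotient -/

theorem continuous_proj : Continuous D.proj := continuous_quotient_mk'

theorem proj_smul (γ : D.group) (x : D.domain) : D.proj (γ • x) = D.proj x :=
  Quotient.sound ⟨γ, rfl⟩

theorem proj_image_eq_univ :
    D.proj '' (((↑) : D.domain → X) ⁻¹' level D.gen D.ball 0) = Set.univ := by
  refine Set.eq_univ_of_forall fun q => ?_
  obtain ⟨x, rfl⟩ := Quotient.exists_rep q
  obtain ⟨γ, y, hy, rfl⟩ := D.exists_mem_fundamentalSet x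
  exact ⟨y, hy, (D.proj_smul γ y).symm⟩

theorem compactSpace_orbitSpace [CompactSpace X] : CompactSpace D.orbitSpace := by
  rw [← isCompact_univ_iff, ← D.proj_image_eq_univ]
  refine IsCompact.image ?_ D.continuous_proj
  refine (Topology.IsInducing.subtypeVal.isCompact_preimage_iff ?_).2
    (D.isPingPong.isClosed_level 0).isCompact
  exact (D.level_subset_domain 0).trans_eq Subtype.range_coe.symm

theorem connectedSpace_orbitSpace [FiniteDimensional ℂ E] [T2Space X] [ConnectedSpace X] :
    ConnectedSpace D.orbitSpace := by
  rw [connectedSpace_iff_univ, ← D.proj_image_eq_univ]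
  exact (isPathConnected_preimage_val (D.isPathConnected_level 0)
    (D.level_subset_domain 0)).isConnected.image _ D.continuous_proj.continuousOn

instance : IsCancelSMul D.group D.domain :=
  isCancelSMul_iff_eq_one_of_smul_eq.2 fun γ x => D.eq_one_of_smul_eq γ x

theorem locallyCompactSpace_domain [T2Space X] [CompactSpace X] :
    LocallyCompactSpace D.domain :=
  D.isOpen_domain.locallyCompactSpace

theorem isQuotientCoveringMap_proj [T2Space X] [CompactSpace X] :
    IsQuotientCoveringMap D.proj D.group :=
  have := D.locallyCompactSpace_domain
  isQuotientCoveringMap_quotientMk_of_properlyDiscontinuousSMul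

theorem t2Space_orbitSpace [T2Space X] [CompactSpace X] : T2Space D.orbitSpace :=
  have := D.locallyCompactSpace_domain
  t2Space_of_properlyDiscontinuousSMul_of_t2Space

/-- The domain is simply connected as an increasing union of simply connected levels each of which
lies in the interior of the next. -/
theorem simplyConnectedSpace_domain [FiniteDimensional ℂ E] [T2Space X] [SimplyConnectedSpace X]
    (hflat : ∀ b, IsLocallyFlat E 3 (core S b)) : SimplyConnectedSpace D.domain := by
  change IsSimplyConnected (D.domain : Set X)
  rw [isSimplyConnected_iff_exists_homotopy_refl_forall_mem]
  have hlev := fun n => isSimplyConnected_iff_exists_homotopy_refl_forall_mem.1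
    (D.isSimplyConnected_level hflat n)
  constructor
  · obtain ⟨x, hx⟩ := (hlev 0).1.nonempty
    refine ⟨x, D.level_subset_domain 0 hx, fun {y} hy => ?_⟩
    obtain ⟨n, hn⟩ := (D.mem_domain_iff y).1 hy
    exact ((hlev n).1.joinedIn x (D.isPingPong.level_mono (Nat.zero_le n) hx) y hn).mono
      (D.level_subset_domain n)
  · intro x p hp
    obtain ⟨n, hn⟩ := D.isPingPong.exists_level_of_isCompact (isCompact_range p.continuous)
      (by rintro _ ⟨t, rfl⟩; exact (D.mem_domain_iff _).1 (hp t))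
    obtain ⟨F, hF⟩ := (hlev n).2 x p fun t => hn ⟨t, rfl⟩
    exact ⟨F, fun t => D.level_subset_domain n (hF t)⟩

theorem nonempty_fundamentalGroup_mulEquiv [FiniteDimensional ℂ E] [T2Space X] [CompactSpace X]
    [SimplyConnectedSpace X] (h₀ : ∃ k ≥ 2, IsComplexSubmanifold E k S.C₀)
    (h₁ : ∃ k ≥ 2, IsComplexSubmanifold E k S.C₁) (q : D.orbitSpace) :
    Nonempty (FundamentalGroup D.orbitSpace q ≃* D.group) := by
  have hflat : ∀ b, IsLocallyFlat E 3 (core S b) := by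
    obtain ⟨k₀, hk₀, hC₀⟩ := h₀
    obtain ⟨k₁, hk₁, hC₁⟩ := h₁
    rintro (_ | _)
    · exact hC₀.isLocallyFlat.mono (by omega)
    · exact hC₁.isLocallyFlat.mono (by omega)
  have := D.simplyConnectedSpace_domain hflat
  obtain ⟨x, hx⟩ := Quotient.exists_rep q
  -- the deck group of a covering is anti-isomorphic to the fundamental group; invert elements
  exact ⟨(D.isQuotientCoveringMap_proj.fundamentalGroupEquiv ⟨x, hx⟩).trans
    (MulEquiv.inv' D.group).symm⟩

end SchottkyData

/-! ### Manifold structures on quotients -/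

section QuotientManifold

variable {𝕜 E M Q : Type*} [NontriviallyNormedField 𝕜] [NormedAddCommGroup E] [NormedSpace 𝕜 E]
  [TopologicalSpace M] [ChartedSpace E M] [TopologicalSpace Q] {n : WithTop ℕ∞} {p : M → Q}

theorem IsLocalHomeomorph.localInverseAt_comp_eventuallyEq (hp : IsLocalHomeomorph p) {a x : M}
    {γ : M → M} (hγ : ContinuousAt γ x) (hpγ : ∀ z, p (γ z) = p z)
    (hx : p x ∈ (hp.localInverseAt a).source) (hγx : γ x = hp.localInverseAt a (p x)) :
    hp.localInverseAt a ∘ p =ᶠ[𝓝 x] γ := by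
  have h : ∀ᶠ z in 𝓝 x, γ z ∈ (hp.localInverseAt a).target := by
    refine hγ.eventually_mem ((hp.localInverseAt a).open_target.mem_nhds ?_)
    rw [hγx]
    exact (hp.localInverseAt a).map_source hx
  filter_upwards [h] with z hz
  have h2 := (hp.localInverseAt a).right_inv hz
  rw [hp.localInverseAt_symm, hpγ] at h2
  exact h2

/-- If the fibres of a local homeomorphism `p` are orbits of smooth maps over `p`, then the local
inverses of `p` become smooth when composed with `p`: near each point they agree with one of these
maps. -/
theorem IsLocalHomeomorph.contMDiffAt_localInverseAt_comp (hp : IsLocalHomeomorph p)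
    (hdeck : ∀ x y, p x = p y → ∃ γ : M → M, ContMDiff 𝓘(𝕜, E) 𝓘(𝕜, E) n γ ∧
      (∀ z, p (γ z) = p z) ∧ γ x = y) {a x : M} (hx : p x ∈ (hp.localInverseAt a).source) :
    ContMDiffAt 𝓘(𝕜, E) 𝓘(𝕜, E) n (hp.localInverseAt a ∘ p) x := by
  obtain ⟨γ, hγ, hpγ, hγx⟩ := hdeck x (hp.localInverseAt a (p x))
    (hp.apply_localInverseAt_of_mem hx).symm
  exact (hγ x).congr_of_eventuallyEq
    (hp.localInverseAt_comp_eventuallyEq hγ.continuous.continuousAt hpγ hx hγx)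

/-- The base of a surjective local homeomorphism whose fibres are orbits of smooth maps over it is
a manifold, in such a way that the local homeomorphism is a local diffeomorphism. The charts are
local inverses of the map followed by charts of the total space. -/
theorem IsLocalHomeomorph.exists_isManifold [IsManifold 𝓘(𝕜, E) n M] (hp : IsLocalHomeomorph p)
    (hsurj : Function.Surjective p)
    (hdeck : ∀ x y, p x = p y → ∃ γ : M → M, ContMDiff 𝓘(𝕜, E) 𝓘(𝕜, E) n γ ∧
      (∀ z, p (γ z) = p z) ∧ γ x = y) :
    ∃ _ : ChartedSpace E Q, IsManifold 𝓘(𝕜, E) n Q ∧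
      IsLocalDiffeomorph 𝓘(𝕜, E) 𝓘(𝕜, E) n p := by
  obtain ⟨g, hg⟩ := hsurj.hasRightInverse
  let _ : ChartedSpace E Q := hp.chartedSpaceOfRightInverse hg
  have hchart : ∀ q : Q, chartAt E q = (hp.localInverseAt (g q)).trans (chartAt E (g q)) :=
    fun _ => rfl
  have hmfd : IsManifold 𝓘(𝕜, E) n Q := by
    refine isManifold_of_contDiffOn _ _ _ ?_
    rintro _ _ ⟨q, rfl⟩ ⟨q', rfl⟩
    intro u hu
    simp only [modelWithCornersSelf_coe, modelWithCornersSelf_coe_symm, Set.range_id,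
      Set.inter_univ, Set.preimage_id_eq, id_eq, OpenPartialHomeomorph.trans_source,
      OpenPartialHomeomorph.symm_source, OpenPartialHomeomorph.trans_target, Set.mem_inter_iff,
      Set.mem_preimage, OpenPartialHomeomorph.coe_trans_symm, Function.comp_apply,
      hp.localInverseAt_symm] at hu
    obtain ⟨⟨hu1, hu2⟩, hu3, hu4⟩ := hu
    refine ContDiffAt.contDiffWithinAt ?_
    rw [← contMDiffAt_iff_contDiffAt]
    have h1 : ContMDiffAt 𝓘(𝕜, E) 𝓘(𝕜, E) n (chartAt E (g q)).symm u :=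
      contMDiffAt_symm_of_mem_maximalAtlas (IsManifold.chart_mem_maximalAtlas _) hu1
    have h2 := hp.contMDiffAt_localInverseAt_comp hdeck hu3
    have h3 : ContMDiffAt 𝓘(𝕜, E) 𝓘(𝕜, E) n (chartAt E (g q'))
        (hp.localInverseAt (g q') (p ((chartAt E (g q)).symm u))) :=
      contMDiffAt_of_mem_maximalAtlas (IsManifold.chart_mem_maximalAtlas _) hu4
    have h4 := h3.comp u (h2.comp u h1)
    refine h4.congr_of_eventuallyEq (Filter.Eventually.of_forall fun z => ?_)
    simp [Function.comp_apply]
  refine ⟨_, hmfd, fun x => ⟨⟨(hp.localInverseAt x).symm.toPartialEquiv,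
    (hp.localInverseAt x).open_target, (hp.localInverseAt x).open_source, ?_, ?_⟩,
    hp.self_mem_localInverseAt_target, fun z _ => ?_⟩⟩
  · intro z _
    refine ContMDiffAt.contMDiffWithinAt ?_
    change ContMDiffAt 𝓘(𝕜, E) 𝓘(𝕜, E) n (hp.localInverseAt x).symm z
    rw [hp.localInverseAt_symm]
    have hz : p z ∈ (chartAt E (p z)).source := mem_chart_source E (p z)
    have hz1 := hz
    rw [hchart] at hz1
    simp only [OpenPartialHomeomorph.trans_source, Set.mem_inter_iff, Set.mem_preimage] at hz1
    have h1 := hp.contMDiffAt_localInverseAt_comp hdeck hz1.1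
    have h2 : ContMDiffAt 𝓘(𝕜, E) 𝓘(𝕜, E) n (chartAt E (g (p z)))
        (hp.localInverseAt (g (p z)) (p z)) :=
      contMDiffAt_of_mem_maximalAtlas (IsManifold.chart_mem_maximalAtlas _) hz1.2
    have h3 : ContMDiffAt 𝓘(𝕜, E) 𝓘(𝕜, E) n (chartAt E (p z)).symm (chartAt E (p z) (p z)) :=
      contMDiffAt_symm_of_mem_maximalAtlas (IsManifold.chart_mem_maximalAtlas _)
        ((chartAt E (p z)).map_source hz)
    have h4 : ContMDiffAt 𝓘(𝕜, E) 𝓘(𝕜, E) n (chartAt E (p z) ∘ p) z :=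
      ContMDiffAt.comp (g := chartAt E (g (p z))) z h2 h1
    refine (h3.comp z h4).congr_of_eventuallyEq ?_
    filter_upwards [hp.continuous.continuousAt.eventually_mem
      ((chartAt E (p z)).open_source.mem_nhds hz)] with w hw
    exact ((chartAt E (p z)).left_inv hw).symm
  · intro y hy
    refine ContMDiffAt.contMDiffWithinAt ?_
    change ContMDiffAt 𝓘(𝕜, E) 𝓘(𝕜, E) n (hp.localInverseAt x) y
    have hy' : y ∈ (hp.localInverseAt x).source := hy
    have hyc : y ∈ (chartAt E y).source := mem_chart_source E y
    have h1 : ContMDiffAt 𝓘(𝕜, E) 𝓘(𝕜, E) n (chartAt E y) y :=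
      contMDiffAt_of_mem_maximalAtlas (IsManifold.chart_mem_maximalAtlas _) hyc
    have h2 : ContMDiffAt 𝓘(𝕜, E) 𝓘(𝕜, E) n (chartAt E (g y)).symm (chartAt E y y) := by
      refine contMDiffAt_symm_of_mem_maximalAtlas (IsManifold.chart_mem_maximalAtlas _) ?_
      have h : chartAt E y y ∈ ((hp.localInverseAt (g y)).trans (chartAt E (g y))).target :=
        (chartAt E y).map_source hyc
      rw [OpenPartialHomeomorph.trans_target] at h
      exact h.1
    have hsymm : ∀ z, (chartAt E y).symm z = p ((chartAt E (g y)).symm z) := fun z => by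
      simp only [hchart, OpenPartialHomeomorph.coe_trans_symm, Function.comp_apply,
        hp.localInverseAt_symm]
    have h3 := h2.comp y h1
    have hval : p ((chartAt E (g y)).symm (chartAt E y y)) = y := by
      rw [← hsymm, (chartAt E y).left_inv hyc]
    have h4 := hp.contMDiffAt_localInverseAt_comp hdeck (a := x)
      (x := (chartAt E (g y)).symm (chartAt E y y)) (by rwa [hval])
    refine (h4.comp y h3).congr_of_eventuallyEq ?_
    filter_upwards [(chartAt E y).open_source.mem_nhds hyc] with w hw
    simp only [Function.comp_apply]
    rw [← hsymm, (chartAt E y).left_inv hw]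
  · change p z = (hp.localInverseAt x).symm z
    rw [hp.localInverseAt_symm]

end QuotientManifold

namespace SchottkyData

variable {E X : Type*} [NormedAddCommGroup E] [NormedSpace ℂ E]
  [TopologicalSpace X] [ChartedSpace E X] {S : SchottkyPair E X} {r : ℕ} (D : SchottkyData S r)

theorem exists_isManifold_orbitSpace [IsManifold 𝓘(ℂ, E) ω X] [T2Space X] [CompactSpace X] :
    ∃ (hU : IsOpen (D.domain : Set X)) (_ : ChartedSpace E D.orbitSpace),
      IsManifold 𝓘(ℂ, E) ω D.orbitSpace ∧
      IsLocalDiffeomorph 𝓘(ℂ, E) 𝓘(ℂ, E) ω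
        (fun x : (⟨(D.domain : Set X), hU⟩ : TopologicalSpace.Opens X) =>
          D.proj ⟨x.1, x.2⟩) := by
  refine ⟨D.isOpen_domain, IsLocalHomeomorph.exists_isManifold ?_ ?_ ?_⟩
  · exact D.isQuotientCoveringMap_proj.isCoveringMap.isLocalHomeomorph
  · exact Quotient.mk_surjective
  · intro x y hxy
    obtain ⟨γ, hγ⟩ : ∃ γ : D.group, γ • (⟨x.1, x.2⟩ : D.domain) = ⟨y.1, y.2⟩ :=
      MulAction.orbitRel_apply.1 (Quotient.exact hxy.symm)
    refine ⟨fun z => ⟨(γ • (⟨z.1, z.2⟩ : D.domain)).1, (γ • (⟨z.1, z.2⟩ : D.domain)).2⟩, ?_,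
      fun z => D.proj_smul γ ⟨z.1, z.2⟩, Subtype.ext (congrArg Subtype.val hγ)⟩
    exact fun z => (ChartedSpace.liftPropWithinAt_subtypeVal_comp_iff ..).1
      ((γ : HolAut E X).contMDiff.comp contMDiff_subtype_val z)

theorem secondCountableTopology_orbitSpace [FiniteDimensional ℂ E] [IsManifold 𝓘(ℂ, E) ω X]
    [T2Space X] [CompactSpace X] : SecondCountableTopology D.orbitSpace := by
  obtain ⟨_, _, -, -⟩ := D.exists_isManifold_orbitSpace
  have := D.compactSpace_orbitSpace
  have := FiniteDimensional.proper ℂ E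
  exact ChartedSpace.secondCountable_of_sigmaCompact E _

end SchottkyData

theorem proposition2p4 {E X : Type*} [NormedAddCommGroup E] [NormedSpace ℂ E]
    [FiniteDimensional ℂ E] [TopologicalSpace X] [ChartedSpace E X]
    [IsManifold 𝓘(ℂ, E) ω X] [T2Space X] [CompactSpace X] [ConnectedSpace X]
    (S : SchottkyPair E X) (r : ℕ) (D : SchottkyData S r) :
    -- the group is free on the given generators
    (∃ e : FreeGroup (Fin r) ≃* D.group,
      ∀ j, (e (FreeGroup.of j) : HolAut E X) = D.gen j) ∧
    -- the action on the domain is free and proper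
    (∀ (γ : D.group) (x : D.domain), γ • x = x → γ = 1) ∧
    ProperlyDiscontinuousSMul D.group D.domain ∧
    -- the connected set is a fundamental domain
    IsConnected D.fundamentalSet ∧
    IsTopFundamentalDomain D.group {x : D.domain | (x : X) ∈ D.fundamentalSet} ∧
    -- the quotient is a connected compact complex manifold
    CompactSpace D.orbitSpace ∧ ConnectedSpace D.orbitSpace ∧ T2Space D.orbitSpace ∧
    SecondCountableTopology D.orbitSpace ∧
    (∃ (hU : IsOpen (D.domain : Set X)) (_ : ChartedSpace E D.orbitSpace),
      IsManifold 𝓘(ℂ, E) ω D.orbitSpace ∧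
      IsLocalDiffeomorph 𝓘(ℂ, E) 𝓘(ℂ, E) ω
        (fun x : (⟨(D.domain : Set X), hU⟩ : TopologicalSpace.Opens X) =>
          D.proj ⟨x.1, x.2⟩)) ∧
    -- the fundamental group of the quotient
    (SimplyConnectedSpace X →
      (∃ k ≥ 2, IsComplexSubmanifold E k S.C₀) →
      (∃ k ≥ 2, IsComplexSubmanifold E k S.C₁) →
      ∀ q : D.orbitSpace, Nonempty (FundamentalGroup D.orbitSpace q ≃* D.group)) :=
  ⟨D.exists_freeGroup_mulEquiv, D.eq_one_of_smul_eq, inferInstance,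
    D.fundamentalSet_eq ▸ (D.isPathConnected_level 0).isConnected, D.isTopFundamentalDomain,
    D.compactSpace_orbitSpace, D.connectedSpace_orbitSpace, D.t2Space_orbitSpace,
    D.secondCountableTopology_orbitSpace, D.exists_isManifold_orbitSpace,
    fun _ h₀ h₁ q => D.nonempty_fundamentalGroup_mulEquiv h₀ h₁ q⟩
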